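/- For every integer $k\ge 4$ there are a constant $c_k>0$ and an integer $N_k$ such that the following holds for every set $S$ of $n\ge N_k$ points in the plane in general position (no three on a line). There is a family of at least $c_k n$ simple convex $k$-cycles with vertices in $S$ such that any two of them are vertex-disjoint and cross. Furthermore, for $k=4$ one can take $c_4=1/22$. Here a $k$-cycle of $S$ is a sequence $s_0,\dots,s_{k-1}$ of $k$ distinct points of $S$ together with its edges, the line segments $s_is_{i+1}$ (indices modulo $k$). It is simple if two different edges never meet except in a common endpoint, and a simple cycle is convex if its vertices are in convex position (no vertex lies in the convex hull of the others). Two vertex-disjoint cycles cross if some edge of the first and some edge of the second have a common point that is interior to both edges. -/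

import Mathlib

/-- The Euclidean plane. -/
abbrev Plane : Type := EuclideanSpace ℝ (Fin 2)

/-- A finite set of points of the plane is in general position if no three distinct points of it
are collinear. -/
def InGeneralPosition (S : Finset Plane) : Prop :=
  ∀ p ∈ S, ∀ q ∈ S, ∀ r ∈ S, p ≠ q → q ≠ r → p ≠ r → ¬ Collinear ℝ ({p, q, r} : Set Plane)

/-- A (geometric) `k`-cycle of `S`: a sequence `s_0, …, s_{k-1}` of distinct points of `S`. Its
edges are the segments joining `s_i` to `s_{i+1}`, the indices being taken modulo `k`. -/
@[ext]
structure GeomCycle (S : Finset Plane) (k : ℕ) where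
  vertex : Fin k → Plane
  vertex_mem : ∀ i, vertex i ∈ S
  vertex_injective : Function.Injective vertex

namespace GeomCycle

variable {S : Finset Plane} {k : ℕ}

/-- The vertex following `s_i` in cyclic order; `finRotate k` is the permutation
`i ↦ i + 1 (mod k)` of `Fin k`. -/
def next (C : GeomCycle S k) (i : Fin k) : Plane := C.vertex (finRotate k i)

/-- The `i`-th edge of the cycle: the closed segment from `s_i` to `s_{i+1}`. -/
def edge (C : GeomCycle S k) (i : Fin k) : Set Plane := segment ℝ (C.vertex i) (C.next i)

/-- The interior of the `i`-th edge of the cycle: the open segment from `s_i` to `s_{i+1}`. -/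
def edgeInterior (C : GeomCycle S k) (i : Fin k) : Set Plane :=
  openSegment ℝ (C.vertex i) (C.next i)

/-- A cycle is simple if it has no self-intersections: two different edges have no common point
other than a common endpoint. -/
def IsSimple (C : GeomCycle S k) : Prop :=
  ∀ i j : Fin k, i ≠ j → ∀ x ∈ C.edge i ∩ C.edge j,
    x ∈ ({C.vertex i, C.next i} : Set Plane) ∩ {C.vertex j, C.next j}

/-- The vertices of the cycle are in convex position: none of them lies in the convex hull of the
others. -/
def InConvexPosition (C : GeomCycle S k) : Prop := ConvexIndependent ℝ C.vertex

/-- A simple convex cycle. -/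
def IsSimpleConvex (C : GeomCycle S k) : Prop := C.IsSimple ∧ C.InConvexPosition

/-- Two cycles are vertex disjoint. -/
def VertexDisjoint (C D : GeomCycle S k) : Prop :=
  Disjoint (Set.range C.vertex) (Set.range D.vertex)

/-- Two vertex disjoint cycles cross if there are an edge of the one and an edge of the other that
have a common point in the interior of both. -/
def Cross (C D : GeomCycle S k) : Prop :=
  C.VertexDisjoint D ∧ ∃ i j : Fin k, (C.edgeInterior i ∩ D.edgeInterior j).Nonempty

end GeomCycle

/-- A crossing family of `k`-cycles of `S`: any two different members are vertex disjoint and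
cross. -/
def IsCrossingFamily {S : Finset Plane} {k : ℕ} (F : Finset (GeomCycle S k)) : Prop :=
  ∀ C ∈ F, ∀ D ∈ F, C ≠ D → C.Cross D

/-! Everything rests on a crossing criterion, `GeomCycle.cross_of_not_nested`: two vertex-disjoint
convex polygons whose regions meet, each with a vertex outside the other's region, must cross.
Non-nesting is certified by linear functionals (`IsCcw.eq_of_mem_region_of_le`): one polygon sticks
out in one direction, the other in another. A shear makes abscissas distinct, and orientations
replace all metric data.

For general k, suppose k clusters of m points lie from left to right and every transversal triple is
a cup. Joining the i-th leftmost points of the clusters gives m polygons. The earlier of two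
polygons sticks out on the left, the later on the right, and their regions meet because a mixed
transversal quadrilateral has crossing diagonals (`hasCrossingFamily_of_cup_clusters`). Such
clusters are found by cutting the points into a constant number of blocks, shrinking these by
halving lines until each triple of blocks has a fixed orientation (`exists_sameOrientation`), and
applying an Erdős–Szekeres argument to representatives (`exists_homogeneous`). Caps become cups by
reflection.

For k = 4, 18m points suffice (`hasCrossingFamily_four`). Up to reflection, a common halving line of
the 8m leftmost points and the points right of the middle 2m leaves 4m points on either flank above
it and m middle points below it. Either m disjoint caps run between the flanks, and each is
completed to a quadrilateral by a middle point; or deleting the points of a maximal set of disjoint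
caps leaves 2m points on each flank with no cap between them, and halving each flank gives four cup
clusters. -/

/-! ### Orientation of triples of points -/

/-- Twice the signed area of the triangle `p q r`. -/
def orient (p q r : Plane) : ℝ := (q 0 - p 0) * (r 1 - p 1) - (q 1 - p 1) * (r 0 - p 0)

lemma orient_rotate (p q r : Plane) : orient q r p = orient p q r := by
  unfold orient; ring

lemma orient_swap (p q r : Plane) : orient p r q = -orient p q r := by
  unfold orient; ring

@[simp] lemma orient_self_left (p q : Plane) : orient p q p = 0 := by
  unfold orient; ring

@[simp] lemma orient_self_right (p q : Plane) : orient p q q = 0 := by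
  unfold orient; ring

lemma orient_combo (p q x y : Plane) {a b : ℝ} (hab : a + b = 1) :
    orient p q (a • x + b • y) = a * orient p q x + b * orient p q y := by
  obtain rfl : b = 1 - a := by linarith
  simp [orient]; ring

lemma continuous_orient (p q : Plane) : Continuous (orient p q) := by
  unfold orient; fun_prop

lemma plane_ext {p q : Plane} (h0 : p 0 = q 0) (h1 : p 1 = q 1) : p = q := by
  ext i; fin_cases i
  · exact h0
  · exact h1

/-- A point on the line through two distinct points is an affine combination of them. -/
lemma exists_lineMap_of_orient_eq_zero {p q x : Plane} (hpq : p ≠ q) (h : orient p q x = 0) :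
    ∃ t : ℝ, x = (1 - t) • p + t • q := by
  unfold orient at h
  by_cases h0 : q 0 - p 0 = 0
  · have h1 : q 1 - p 1 ≠ 0 := fun h1 ↦ hpq (plane_ext (by linarith) (by linarith))
    refine ⟨(x 1 - p 1) / (q 1 - p 1), plane_ext ?_ ?_⟩
    · have : x 0 - p 0 = 0 := by
        rw [h0] at h; simpa [h1] using h
      simp; field_simp; linear_combination (q 1 - p 1) * this - (x 1 - p 1) * h0
    · simp; field_simp; ring
  · refine ⟨(x 0 - p 0) / (q 0 - p 0), plane_ext ?_ ?_⟩
    · simp; field_simp; ring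
    · simp; field_simp; linear_combination h

lemma collinear_of_orient_eq_zero {p q r : Plane} (h : orient p q r = 0) :
    Collinear ℝ ({p, q, r} : Set Plane) := by
  by_cases hpq : p = q
  · subst hpq; simpa using collinear_pair ℝ p r
  · obtain ⟨t, rfl⟩ := exists_lineMap_of_orient_eq_zero hpq h
    refine (collinear_iff_of_mem (p₀ := p) (by simp)).2 ⟨q - p, ?_⟩
    rintro x (rfl | rfl | rfl)
    · exact ⟨0, by simp⟩
    · exact ⟨1, by simp⟩
    · exact ⟨t, by simp only [vadd_eq_add]; module⟩

/-- No three distinct points of `S` have vanishing orientation. -/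
def OrientNonzero (S : Finset Plane) : Prop :=
  ∀ p ∈ S, ∀ q ∈ S, ∀ r ∈ S, p ≠ q → q ≠ r → p ≠ r → orient p q r ≠ 0

lemma InGeneralPosition.orientNonzero {S : Finset Plane} (hS : InGeneralPosition S) :
    OrientNonzero S := fun p hp q hq r hr h1 h2 h3 h ↦
  hS p hp q hq r hr h1 h2 h3 (collinear_of_orient_eq_zero h)

/-- If the lines through `p r` and through `q s` separate the end points of the other segment, then
the segments meet. -/
lemma segments_meet {p q r s : Plane} (h1 : orient p r q < 0) (h2 : 0 < orient p r s)
    (h3 : 0 < orient q s p) (h4 : orient q s r < 0) :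
    (segment ℝ p r ∩ segment ℝ q s).Nonempty := by
  -- `d` is the cross product of `r - p` and `s - q`; the coefficients below are Cramer's rule for
  -- the intersection of the two lines.
  set d := orient p r s - orient p r q with hd
  have hd' : d = orient q s p - orient q s r := by rw [hd]; unfold orient; ring
  have hpos : 0 < d := by rw [hd]; linarith
  refine ⟨(orient p r s / d) • q + (-orient p r q / d) • s, ?_, ?_⟩
  · refine ⟨-orient q s r / d, orient q s p / d, by apply div_nonneg <;> linarith,
      by apply div_nonneg <;> linarith, ?_, ?_⟩
    · rw [← add_div, div_eq_one_iff_eq hpos.ne', hd']; ring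
    · refine plane_ext ?_ ?_ <;> simp <;> field_simp <;> unfold orient <;> ring
  · refine ⟨orient p r s / d, -orient p r q / d, by apply div_nonneg <;> linarith,
      by apply div_nonneg <;> linarith, ?_, rfl⟩
    rw [← add_div, div_eq_one_iff_eq hpos.ne', hd]; ring

/-- If four distinct points are in general position, a common point of two segments spanned by them
is interior to both. -/
lemma mem_openSegment_of_mem_segment {p q r s x : Plane} (h1 : orient r s p ≠ 0)
    (h2 : orient r s q ≠ 0) (hx : x ∈ segment ℝ p q) (hx' : x ∈ segment ℝ r s) :
    x ∈ openSegment ℝ p q := by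
  have h0 : orient r s x = 0 := by
    obtain ⟨a, b, -, -, hab, rfl⟩ := hx'
    rw [orient_combo _ _ _ _ hab]; simp
  rw [← insert_endpoints_openSegment] at hx
  rcases hx with rfl | rfl | hx
  · exact absurd h0 h1
  · exact absurd h0 h2
  · exact hx

/-! ### Convex polygons -/

/-- The vertices `v 0, …, v (k - 1)` are the vertices of a convex polygon in counterclockwise
order. -/
def IsCcw {k : ℕ} (v : Fin k → Plane) : Prop :=
  ∀ i j l, i < j → j < l → 0 < orient (v i) (v j) (v l)

lemma finRotate_val {k : ℕ} (i : Fin k) :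
    (finRotate k i : ℕ) = if (i : ℕ) + 1 = k then 0 else (i : ℕ) + 1 := by
  cases k with
  | zero => exact i.elim0
  | succ n => rw [coe_finRotate]; simp [Fin.ext_iff]

lemma finRotate_ne_self {k : ℕ} (hk : 3 ≤ k) (i : Fin k) : finRotate k i ≠ i := by
  have := finRotate_val i
  intro h; rw [h] at this; split_ifs at this <;> omega

lemma finRotate_finRotate_ne_self {k : ℕ} (hk : 3 ≤ k) (i : Fin k) :
    finRotate k (finRotate k i) ≠ i := by
  have h1 := finRotate_val i
  have h2 := finRotate_val (finRotate k i)
  intro h; rw [h] at h2; split_ifs at h1 h2 <;> omega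

/-- A set of indices that is closed under passing to the next one is empty or everything. -/
lemma forall_of_finRotate {k : ℕ} (hk : 3 ≤ k) {P : Fin k → Prop}
    (hP : ∀ i, P i → P (finRotate k i)) {i : Fin k} (hi : P i) (j : Fin k) : P j := by
  have hs := (isCycle_finRotate_of_le (by omega : 2 ≤ k)).sameCycle (finRotate_ne_self hk i)
    (finRotate_ne_self hk j)
  obtain ⟨n, -, rfl⟩ := hs.exists_pow_eq'
  induction n with
  | zero => simpa using hi
  | succ n ih =>
    rw [pow_succ', Equiv.Perm.mul_apply]
    exact hP _ (ih ((isCycle_finRotate_of_le (by omega : 2 ≤ k)).sameCycle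
      (finRotate_ne_self hk i) (finRotate_ne_self hk _)))

namespace IsCcw

variable {k : ℕ} {v : Fin k → Plane}

/-- `IsCcw` speaks of increasing triples only; cyclic invariance of `orient` covers the closing edge
and the vertices preceding the edge. -/
lemma edge_pos (hv : IsCcw v) {i j : Fin k} (h1 : j ≠ i) (h2 : j ≠ finRotate k i) :
    0 < orient (v i) (v (finRotate k i)) (v j) := by
  have h := finRotate_val i
  rw [Ne, Fin.ext_iff] at h1 h2
  split_ifs at h with h3
  · rw [← orient_rotate]
    exact hv _ _ _ (by rw [Fin.lt_def]; omega) (by rw [Fin.lt_def]; omega)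
  · rcases lt_or_gt_of_ne h1 with h4 | h4
    · rw [orient_rotate]
      exact hv _ _ _ (by rw [Fin.lt_def]; omega) (by rw [Fin.lt_def]; omega)
    · exact hv _ _ _ (by rw [Fin.lt_def]; omega) (by rw [Fin.lt_def]; omega)

lemma edge_nonneg (hv : IsCcw v) (i j : Fin k) :
    0 ≤ orient (v i) (v (finRotate k i)) (v j) := by
  by_cases h1 : j = i
  · subst h1; simp
  by_cases h2 : j = finRotate k i
  · subst h2; simp
  exact (hv.edge_pos h1 h2).le

end IsCcw

/-- The intersection of the half planes to the left of the edges of a polygon. -/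
def region {k : ℕ} (v : Fin k → Plane) : Set Plane :=
  {x | ∀ i, 0 ≤ orient (v i) (v (finRotate k i)) x}

lemma convex_region {k : ℕ} (v : Fin k → Plane) : Convex ℝ (region v) := by
  intro x hx y hy a b ha hb hab i
  rw [orient_combo _ _ _ _ hab]
  exact add_nonneg (mul_nonneg ha (hx i)) (mul_nonneg hb (hy i))

/-- A segment that leaves the region of a polygon does so through an edge line. -/
lemma exists_exit {k : ℕ} {v : Fin k → Plane} {q c : Plane} (hq : q ∈ region v)
    (hc : c ∉ region v) :
    ∃ x ∈ segment ℝ q c, x ∈ region v ∧ ∃ i, orient (v i) (v (finRotate k i)) x = 0 := by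
  simp only [region, Set.mem_ofPred_eq, not_forall, not_le] at hc
  obtain ⟨i₀, hi₀⟩ := hc
  have hne : (Finset.univ : Finset (Fin k)).Nonempty := ⟨i₀, Finset.mem_univ _⟩
  set γ : ℝ → Plane := fun t ↦ (1 - t) • q + t • c with hγ
  -- The least edge functional along the segment is continuous, nonnegative at `q` and negative at
  -- `c`. At a zero all functionals are nonnegative and one vanishes.
  set f : ℝ → ℝ := fun t ↦ Finset.univ.inf' hne fun i ↦ orient (v i) (v (finRotate k i)) (γ t)
  have hf : Continuous f := by
    refine Continuous.finset_inf'_apply hne fun i _ ↦ ?_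
    exact (continuous_orient _ _).comp (by fun_prop)
  have h0 : 0 ≤ f 0 := by
    simp only [f, Finset.le_inf'_iff]
    intro i _; simpa [hγ] using hq i
  have h1 : f 1 ≤ 0 := by
    refine (Finset.inf'_le _ (Finset.mem_univ i₀)).trans ?_
    simpa [hγ] using hi₀.le
  obtain ⟨t, ht, hft⟩ := intermediate_value_Icc' zero_le_one hf.continuousOn ⟨h1, h0⟩
  refine ⟨γ t, ⟨1 - t, t, by linarith [ht.2], ht.1, by ring, rfl⟩, fun i ↦ ?_, ?_⟩
  · rw [← hft]; exact Finset.inf'_le _ (Finset.mem_univ i)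
  · obtain ⟨i, -, hi⟩ := Finset.exists_mem_eq_inf' hne
      fun i ↦ orient (v i) (v (finRotate k i)) (γ t)
    exact ⟨i, hi ▸ hft⟩

namespace IsCcw

variable {k : ℕ} {v : Fin k → Plane}

lemma mem_region (hv : IsCcw v) (j : Fin k) : v j ∈ region v := fun i ↦ hv.edge_nonneg i j

lemma ne_next (hk : 3 ≤ k) (hv : IsCcw v) (i : Fin k) : v i ≠ v (finRotate k i) := by
  intro h
  have := hv.edge_pos (i := finRotate k i) (j := i) (finRotate_ne_self hk i).symm
    (finRotate_finRotate_ne_self hk i).symm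
  rw [h] at this
  simp at this

/-- A point of the region on the line of an edge lies on the edge. -/
lemma mem_segment_of_mem_region (hk : 3 ≤ k) (hv : IsCcw v) {x : Plane} (hx : x ∈ region v)
    {i : Fin k} (hi : orient (v i) (v (finRotate k i)) x = 0) :
    x ∈ segment ℝ (v i) (v (finRotate k i)) := by
  obtain ⟨t, rfl⟩ := exists_lineMap_of_orient_eq_zero (hv.ne_next hk i) hi
  -- With the edge starting at the successor of `l`, the preceding edge forces `0 ≤ t` and the
  -- following one forces `t ≤ 1`.
  obtain ⟨l, rfl⟩ := (finRotate k).surjective i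
  have h1 := hx (finRotate k (finRotate k l))
  have h2 := hx l
  rw [orient_combo _ _ _ _ (by ring)] at h1 h2
  have h3 := hv.edge_pos (i := finRotate k (finRotate k l)) (j := finRotate k l)
    (finRotate_ne_self hk _).symm (finRotate_finRotate_ne_self hk _).symm
  have h4 := hv.edge_pos (i := l) (j := finRotate k (finRotate k l))
    (finRotate_finRotate_ne_self hk _) (finRotate_ne_self hk _)
  simp only [orient_self_left, orient_self_right, mul_zero, add_zero, zero_add] at h1 h2
  exact ⟨1 - t, t, nonneg_of_mul_nonneg_left h1 h3, nonneg_of_mul_nonneg_left h2 h4, by ring, rfl⟩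

/-- If `v i` is the only vertex minimising a linear functional, then no other point of the region
is as low as `v i`. -/
lemma eq_of_mem_region_of_le (hk : 3 ≤ k) (hv : IsCcw v) {α β : ℝ} {i : Fin k}
    (hmin : ∀ j, j ≠ i → α * v i 0 + β * v i 1 < α * v j 0 + β * v j 1) {x : Plane}
    (hx : x ∈ region v) (hxi : α * x 0 + β * x 1 ≤ α * v i 0 + β * v i 1) : x = v i := by
  obtain ⟨l, rfl⟩ := (finRotate k).surjective i
  set p := v l
  set q := v (finRotate k l)
  set r := v (finRotate k (finRotate k l))
  have hD : 0 < orient p q r := hv.edge_pos (finRotate_finRotate_ne_self hk _)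
    (finRotate_ne_self hk _)
  have h1 : 0 ≤ orient p q x := hx l
  have h2 : 0 ≤ orient q r x := hx (finRotate k l)
  have hp := hmin l (finRotate_ne_self hk l).symm
  have hr := hmin (finRotate k (finRotate k l)) (finRotate_ne_self hk _)
  -- `x - q` is a nonnegative combination of the two edge directions at `q`, and the functional
  -- strictly increases along both.
  have e0 : orient p q r * (x 0 - q 0) = orient p q x * (r 0 - q 0) + orient q r x * (p 0 - q 0) := by
    unfold orient; ring
  have e1 : orient p q r * (x 1 - q 1) = orient p q x * (r 1 - q 1) + orient q r x * (p 1 - q 1) := by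
    unfold orient; ring
  have key : orient p q x * (α * r 0 + β * r 1 - (α * q 0 + β * q 1)) +
      orient q r x * (α * p 0 + β * p 1 - (α * q 0 + β * q 1)) ≤ 0 := by
    have : orient p q r * (α * x 0 + β * x 1 - (α * q 0 + β * q 1)) ≤ 0 :=
      mul_nonpos_of_nonneg_of_nonpos hD.le (by linarith)
    calc _ = orient p q r * (α * x 0 + β * x 1 - (α * q 0 + β * q 1)) := by
          linear_combination -α * e0 - β * e1
      _ ≤ 0 := this
  have g1 : 0 < α * r 0 + β * r 1 - (α * q 0 + β * q 1) := sub_pos.2 hr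
  have g2 : 0 < α * p 0 + β * p 1 - (α * q 0 + β * q 1) := sub_pos.2 hp
  have m1 := mul_nonneg h1 g1.le
  have m2 := mul_nonneg h2 g2.le
  have z1 : orient p q x = 0 := by
    have : orient p q x * (α * r 0 + β * r 1 - (α * q 0 + β * q 1)) = 0 := by linarith
    exact (mul_eq_zero.1 this).resolve_right g1.ne'
  have z2 : orient q r x = 0 := by
    have : orient q r x * (α * p 0 + β * p 1 - (α * q 0 + β * q 1)) = 0 := by linarith
    exact (mul_eq_zero.1 this).resolve_right g2.ne'
  rw [z1, z2] at e0 e1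
  refine plane_ext ?_ ?_
  · exact sub_eq_zero.1 ((mul_eq_zero.1 (by linarith : orient p q r * (x 0 - q 0) = 0)).resolve_left
      hD.ne')
  · exact sub_eq_zero.1 ((mul_eq_zero.1 (by linarith : orient p q r * (x 1 - q 1) = 0)).resolve_left
      hD.ne')

end IsCcw

/-! ### Simplicity, convexity and crossing of counterclockwise cycles -/

namespace GeomCycle

variable {S : Finset Plane} {k : ℕ}

/-- The whole polygon lies on one side of the line of edge `i`. A point interior to edge `j` on that
line would put both ends of edge `j` among the ends of edge `i`, which is impossible for distinct
edges when `3 ≤ k`. -/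
lemma mem_endpoints_of_mem_edges {C : GeomCycle S k} (hk : 3 ≤ k) (hC : IsCcw C.vertex)
    {i j : Fin k} (hij : i ≠ j) {x : Plane} (hi : x ∈ C.edge i) (hj : x ∈ C.edge j) :
    x ∈ ({C.vertex j, C.next j} : Set Plane) := by
  have h0 : orient (C.vertex i) (C.vertex (finRotate k i)) x = 0 := by
    obtain ⟨a, b, -, -, hab, rfl⟩ := hi
    rw [orient_combo _ _ _ _ hab]; simp [next]
  obtain ⟨a, b, ha, hb, hab, rfl⟩ := hj
  rw [orient_combo _ _ _ _ hab] at h0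
  have n1 := mul_nonneg ha (hC.edge_nonneg i j)
  have n2 := mul_nonneg hb (hC.edge_nonneg i (finRotate k j))
  have z1 : a * orient (C.vertex i) (C.vertex (finRotate k i)) (C.vertex j) = 0 := by
    unfold next at h0; linarith
  have z2 : b * orient (C.vertex i) (C.vertex (finRotate k i)) (C.vertex (finRotate k j)) = 0 := by
    unfold next at h0; linarith
  by_cases ha0 : a = 0
  · obtain rfl : b = 1 := by linarith
    simp [ha0]
  by_cases hb0 : b = 0
  · obtain rfl : a = 1 := by linarith
    simp [hb0]
  exfalso
  have w1 : j = finRotate k i := by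
    by_contra h
    exact (hC.edge_pos hij.symm h).ne' ((mul_eq_zero.1 z1).resolve_left ha0)
  have w2 : finRotate k j = i := by
    by_contra h
    exact (hC.edge_pos h fun h' ↦ hij ((finRotate k).injective h').symm).ne'
      ((mul_eq_zero.1 z2).resolve_left hb0)
  exact finRotate_finRotate_ne_self hk i (w1 ▸ w2)

lemma isSimple_of_isCcw {C : GeomCycle S k} (hk : 3 ≤ k) (hC : IsCcw C.vertex) : C.IsSimple :=
  fun _ _ hij _ hx ↦ ⟨mem_endpoints_of_mem_edges hk hC hij.symm hx.2 hx.1,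
    mem_endpoints_of_mem_edges hk hC hij hx.1 hx.2⟩

lemma inConvexPosition_of_isCcw {C : GeomCycle S k} (hk : 3 ≤ k) (hC : IsCcw C.vertex) :
    C.InConvexPosition := by
  intro s i hi
  by_contra his
  obtain ⟨l, rfl⟩ := (finRotate k).surjective i
  -- The sum of the functionals of the two edges at a vertex vanishes there and is positive at every
  -- other vertex.
  set g : Plane → ℝ := fun x ↦ orient (C.vertex l) (C.vertex (finRotate k l)) x +
    orient (C.vertex (finRotate k l)) (C.vertex (finRotate k (finRotate k l))) x with hg
  have hconv : Convex ℝ {x | 0 < g x} := by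
    intro x hx y hy a b ha hb hab
    have : g (a • x + b • y) = a * g x + b * g y := by
      simp only [hg, orient_combo _ _ _ _ hab]; ring
    rw [Set.mem_ofPred_eq, this]
    rcases ha.eq_or_lt with rfl | ha
    · obtain rfl : b = 1 := by linarith
      simpa using hy
    · exact add_pos_of_pos_of_nonneg (mul_pos ha hx) (mul_nonneg hb (le_of_lt hy))
  have hsub : C.vertex '' s ⊆ {x | 0 < g x} := by
    rintro _ ⟨j, hj, rfl⟩
    have hj' : j ≠ finRotate k l := fun h ↦ his (h ▸ hj)
    by_cases h1 : j = l
    · subst h1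
      exact add_pos_of_nonneg_of_pos (hC.edge_nonneg _ _)
        (hC.edge_pos hj' (finRotate_finRotate_ne_self hk j).symm)
    · exact add_pos_of_pos_of_nonneg (hC.edge_pos h1 hj') (hC.edge_nonneg _ _)
  have := convexHull_min hsub hconv hi
  simp [hg] at this

lemma isSimpleConvex_of_isCcw {C : GeomCycle S k} (hk : 3 ≤ k) (hC : IsCcw C.vertex) :
    C.IsSimpleConvex :=
  ⟨isSimple_of_isCcw hk hC, inConvexPosition_of_isCcw hk hC⟩

lemma Cross.symm {C D : GeomCycle S k} (h : C.Cross D) : D.Cross C := by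
  obtain ⟨h1, i, j, h2⟩ := h
  exact ⟨Disjoint.symm h1, j, i, by rwa [Set.inter_comm]⟩

/-- In general position, disjoint cycles cross as soon as two edges meet. -/
lemma cross_of_edges_meet {C D : GeomCycle S k} (hS : OrientNonzero S) (hk : 3 ≤ k)
    (hCD : C.VertexDisjoint D) {i j : Fin k} {x : Plane} (hi : x ∈ C.edge i) (hj : x ∈ D.edge j) :
    C.Cross D := by
  have hne : ∀ a b, C.vertex a ≠ D.vertex b := fun a b h ↦
    Set.disjoint_left.1 hCD ⟨a, rfl⟩ ⟨b, h.symm⟩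
  have hC : C.vertex i ≠ C.vertex (finRotate k i) :=
    fun h ↦ finRotate_ne_self hk i (C.vertex_injective h).symm
  have hD : D.vertex j ≠ D.vertex (finRotate k j) :=
    fun h ↦ finRotate_ne_self hk j (D.vertex_injective h).symm
  refine ⟨hCD, i, j, x, ?_, ?_⟩
  · exact mem_openSegment_of_mem_segment
      (hS _ (D.vertex_mem _) _ (D.vertex_mem _) _ (C.vertex_mem _) hD (hne _ _).symm (hne _ _).symm)
      (hS _ (D.vertex_mem _) _ (D.vertex_mem _) _ (C.vertex_mem _) hD (hne _ _).symm (hne _ _).symm)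
      hi hj
  · exact mem_openSegment_of_mem_segment
      (hS _ (C.vertex_mem _) _ (C.vertex_mem _) _ (D.vertex_mem _) hC (hne _ _) (hne _ _))
      (hS _ (C.vertex_mem _) _ (C.vertex_mem _) _ (D.vertex_mem _) hC (hne _ _) (hne _ _))
      hj hi

/-- Two convex polygons in general position with intersecting regions, none of which contains the
other, cross. -/
lemma cross_of_not_nested {C D : GeomCycle S k} (hS : OrientNonzero S) (hk : 3 ≤ k)
    (hC : IsCcw C.vertex) (hD : IsCcw D.vertex) (hCD : C.VertexDisjoint D)
    (hq : (region C.vertex ∩ region D.vertex).Nonempty)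
    {i₀ j₀ : Fin k} (hi₀ : C.vertex i₀ ∉ region D.vertex) (hj₀ : D.vertex j₀ ∉ region C.vertex) :
    C.Cross D := by
  obtain ⟨q, hqC, hqD⟩ := hq
  -- An edge of `D` with one point inside the region of `C` and one outside meets the boundary of
  -- `C`.
  have leaves : ∀ p ∈ region C.vertex, ∀ c ∉ region C.vertex, ∀ j, p ∈ D.edge j → c ∈ D.edge j →
      C.Cross D := by
    intro p hp c hc j hpj hcj
    obtain ⟨x, hx, hxr, i, hi⟩ := exists_exit hp hc
    exact cross_of_edges_meet hS hk hCD (hC.mem_segment_of_mem_region hk hxr hi)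
      ((convex_segment _ _).segment_subset hpj hcj hx)
  -- Walking inside `C` from the common point to the vertex outside `D` reaches an edge of `D`
  -- within the region of `C`. Either that edge leaves `C`, or it starts in `C` and some later edge
  -- of `D` must leave on the way to `j₀`.
  obtain ⟨r, hr, hrD, j, hj⟩ := exists_exit hqD hi₀
  have hrC : r ∈ region C.vertex :=
    (convex_region _).segment_subset hqC (hC.mem_region i₀) hr
  have hrj : r ∈ D.edge j := hD.mem_segment_of_mem_region hk hrD hj
  by_cases h1 : D.vertex j ∈ region C.vertex
  · by_contra hcross
    refine hj₀ (forall_of_finRotate hk (P := fun l ↦ D.vertex l ∈ region C.vertex) ?_ h1 j₀)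
    intro l hl
    by_contra hl'
    exact hcross (leaves _ hl _ hl' l (left_mem_segment _ _ _) (right_mem_segment _ _ _))
  · exact leaves _ hrC _ h1 j hrj (left_mem_segment _ _ _)

end GeomCycle


/-! ### Crossing families -/

/-- `S` has a crossing family of `m` simple convex `k`-cycles. -/
def HasCrossingFamily (S : Finset Plane) (k m : ℕ) : Prop :=
  ∃ F : Finset (GeomCycle S k),
    (∀ C ∈ F, C.IsSimpleConvex) ∧ IsCrossingFamily F ∧ m ≤ F.card

lemma hasCrossingFamily_of_fun {S : Finset Plane} {k m : ℕ} (hk : 3 ≤ k)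
    (C : Fin m → GeomCycle S k) (hC : ∀ i, (C i).IsSimpleConvex)
    (hcross : ∀ i j, i < j → (C i).Cross (C j)) : HasCrossingFamily S k m := by
  classical
  have hcross' : ∀ i j, i ≠ j → (C i).Cross (C j) := fun i j hij ↦
    (lt_or_gt_of_ne hij).elim (hcross i j) fun h ↦ (hcross j i h).symm
  have hinj : Function.Injective C := by
    intro i j hij
    by_contra h
    have hd := (hcross' i j h).1
    rw [hij] at hd
    exact Set.disjoint_left.1 hd ⟨⟨0, by omega⟩, rfl⟩ ⟨⟨0, by omega⟩, rfl⟩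
  refine ⟨Finset.univ.image C, by simpa using hC, ?_, ?_⟩
  · intro A hA B hB hAB
    obtain ⟨i, -, rfl⟩ := Finset.mem_image.1 hA
    obtain ⟨j, -, rfl⟩ := Finset.mem_image.1 hB
    exact hcross' i j fun h ↦ hAB (h ▸ rfl)
  · rw [Finset.card_image_of_injective _ hinj]; simp

/-- Crossing families are invariant under linear automorphisms of the plane. -/
lemma HasCrossingFamily.of_image {S : Finset Plane} {k m : ℕ} [DecidableEq Plane] (hk : 3 ≤ k)
    (e : Plane ≃ₗ[ℝ] Plane) (h : HasCrossingFamily (S.image e) k m) : HasCrossingFamily S k m := by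
  obtain ⟨F, hF, hcr, hm⟩ := h
  obtain ⟨g⟩ : Nonempty (Fin m ↪ F) := by
    rw [Function.Embedding.nonempty_iff_card_le]; simpa using hm
  let f : Plane →ₗ[ℝ] Plane := e.symm.toLinearMap
  have hf : Function.Injective f := e.symm.injective
  have hmem : ∀ x ∈ S.image e, f x ∈ S := by
    intro x hx
    obtain ⟨y, hy, rfl⟩ := Finset.mem_image.1 hx
    simpa [f] using hy
  let D : GeomCycle (S.image e) k → GeomCycle S k := fun C ↦
    ⟨fun i ↦ f (C.vertex i), fun i ↦ hmem _ (C.vertex_mem i), hf.comp C.vertex_injective⟩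
  have hedge : ∀ C i, (D C).edge i = f '' C.edge i := fun C i ↦
    (image_segment ℝ f.toAffineMap (C.vertex i) (C.next i)).symm
  have hint : ∀ C i, (D C).edgeInterior i = f '' C.edgeInterior i := fun C i ↦
    (image_openSegment ℝ f.toAffineMap (C.vertex i) (C.next i)).symm
  refine hasCrossingFamily_of_fun hk (fun i ↦ D (g i)) (fun i ↦ ⟨?_, ?_⟩) fun i j hij ↦ ⟨?_, ?_⟩
  · intro a b hab x hx
    rw [hedge, hedge, ← Set.image_inter hf] at hx
    obtain ⟨y, hy, rfl⟩ := hx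
    have := (hF _ (g i).2).1 a b hab y hy
    refine ⟨?_, ?_⟩
    · rcases this.1 with h | h <;> rw [h] <;> simp [D, GeomCycle.next]
    · rcases this.2 with h | h <;> rw [h] <;> simp [D, GeomCycle.next]
  · intro s a ha
    refine (hF _ (g i).2).2 s a ?_
    have h1 : (D (g i)).vertex '' s = f '' ((g i).1.vertex '' s) :=
      Set.image_comp f (g i).1.vertex s
    rw [h1, ← LinearMap.image_convexHull] at ha
    exact hf.mem_set_image.1 ha
  · have := (hcr _ (g i).2 _ (g j).2 fun h ↦ hij.ne (g.injective (Subtype.ext h))).1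
    have hr : ∀ C, Set.range (D C).vertex = f '' Set.range C.vertex := fun C ↦ Set.range_comp f _
    unfold GeomCycle.VertexDisjoint
    rw [hr, hr]
    exact (Set.disjoint_image_iff hf).2 this
  · obtain ⟨a, b, h⟩ := (hcr _ (g i).2 _ (g j).2 fun h ↦ hij.ne (g.injective (Subtype.ext h))).2
    refine ⟨a, b, ?_⟩
    rw [hint, hint, ← Set.image_inter hf]
    exact h.image f

/-- The shear `(x, y) ↦ (x + ε y, y)`. -/
def shear (ε : ℝ) : Plane ≃ₗ[ℝ] Plane where
  toFun p := !₂[p 0 + ε * p 1, p 1]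
  map_add' p q := by refine plane_ext ?_ ?_ <;> simp; ring
  map_smul' a p := by refine plane_ext ?_ ?_ <;> simp; ring
  invFun p := !₂[p 0 - ε * p 1, p 1]
  left_inv p := by refine plane_ext ?_ ?_ <;> simp
  right_inv p := by refine plane_ext ?_ ?_ <;> simp

/-- The reflection `(x, y) ↦ (x, -y)`. -/
def reflect : Plane ≃ₗ[ℝ] Plane where
  toFun p := !₂[p 0, -p 1]
  map_add' p q := by refine plane_ext ?_ ?_ <;> simp; ring
  map_smul' a p := by refine plane_ext ?_ ?_ <;> simp
  invFun p := !₂[p 0, -p 1]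
  left_inv p := by refine plane_ext ?_ ?_ <;> simp
  right_inv p := by refine plane_ext ?_ ?_ <;> simp

@[simp] lemma shear_zero (ε : ℝ) (p : Plane) : shear ε p 0 = p 0 + ε * p 1 := by simp [shear]
@[simp] lemma shear_one (ε : ℝ) (p : Plane) : shear ε p 1 = p 1 := by simp [shear]
@[simp] lemma reflect_zero (p : Plane) : reflect p 0 = p 0 := by simp [reflect]
@[simp] lemma reflect_one (p : Plane) : reflect p 1 = -p 1 := by simp [reflect]

lemma orient_shear (ε : ℝ) (p q r : Plane) :
    orient (shear ε p) (shear ε q) (shear ε r) = orient p q r := by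
  simp [orient]; ring

lemma orient_reflect (p q r : Plane) :
    orient (reflect p) (reflect q) (reflect r) = -orient p q r := by
  simp [orient]; ring

lemma OrientNonzero.image_shear {S : Finset Plane} [DecidableEq Plane] (hS : OrientNonzero S)
    (ε : ℝ) : OrientNonzero (S.image (shear ε)) := by
  simp only [OrientNonzero, Finset.forall_mem_image, orient_shear, (shear ε).injective.ne_iff]
  exact hS

lemma OrientNonzero.image_reflect {S : Finset Plane} [DecidableEq Plane] (hS : OrientNonzero S) :
    OrientNonzero (S.image reflect) := by
  simp only [OrientNonzero, Finset.forall_mem_image, orient_reflect, reflect.injective.ne_iff,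
    neg_ne_zero]
  exact hS

/-- After a suitable shear, the points of a finite set have distinct abscissas. -/
lemma exists_shear_injOn (S : Finset Plane) :
    ∃ ε : ℝ, ∀ p ∈ S, ∀ q ∈ S, shear ε p 0 = shear ε q 0 → p = q := by
  classical
  -- Each pair of points with distinct ordinates excludes one value of `ε`.
  obtain ⟨ε, hε⟩ := ((S ×ˢ S).image fun x ↦ -((x.1 0 - x.2 0) / (x.1 1 - x.2 1))).exists_notMem
  refine ⟨ε, fun p hp q hq h ↦ ?_⟩
  by_contra hpq
  simp only [shear_zero] at h
  by_cases h1 : p 1 - q 1 = 0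
  · have h2 : p 1 = q 1 := by linarith
    rw [h2] at h
    exact hpq (plane_ext (by linarith) h2)
  · refine hε (Finset.mem_image.2 ⟨(p, q), Finset.mk_mem_product hp hq, ?_⟩)
    simp only
    field_simp
    linarith

/-! ### Families of polygons -/

/-- A finite set can be enumerated in the order of a key. -/
lemma exists_sorted_enum {α : Type*} (s : Finset α) (f : α → ℝ) {m : ℕ} (hm : m ≤ s.card) :
    ∃ e : Fin m → α, Function.Injective e ∧ (∀ i, e i ∈ s) ∧ Monotone (f ∘ e) := by
  let g : Fin m → α := fun i ↦ (s.equivFin.symm (Fin.castLE hm i) : α)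
  have hg : Function.Injective g := fun i j hij ↦
    Fin.castLE_injective hm (s.equivFin.symm.injective (Subtype.ext hij))
  refine ⟨g ∘ Tuple.sort (f ∘ g), hg.comp (Tuple.sort _).injective, fun i ↦ ?_,
    Tuple.monotone_sort (f ∘ g)⟩
  exact (s.equivFin.symm _).2

/-- Clusters `U 0, …, U (k - 1)`, ordered from left to right, all of whose transversals are cups
yield a crossing family of `k`-cycles. -/
lemma hasCrossingFamily_of_cup_clusters {S : Finset Plane} (hS : OrientNonzero S)
    (hx : ∀ p ∈ S, ∀ q ∈ S, p 0 = q 0 → p = q) {k m : ℕ} (hk : 4 ≤ k) (U : Fin k → Finset Plane)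
    (hUS : ∀ j, U j ⊆ S) (hm : ∀ j, m ≤ (U j).card)
    (hU : ∀ j j', j < j' → ∀ p ∈ U j, ∀ q ∈ U j', p 0 < q 0)
    (hcup : ∀ j₁ j₂ j₃, j₁ < j₂ → j₂ < j₃ → ∀ p ∈ U j₁, ∀ q ∈ U j₂, ∀ r ∈ U j₃, 0 < orient p q r) :
    HasCrossingFamily S k m := by
  choose e he heU hemono using fun j ↦ exists_sorted_enum (U j) (fun p ↦ p 0) (hm j)
  have hstrict : ∀ j i i', i < i' → e j i 0 < e j i' 0 := fun j i i' hii ↦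
    lt_of_le_of_ne (hemono j hii.le) fun h ↦
      hii.ne (he j (hx _ (hUS j (heU j i)) _ (hUS j (heU j i')) h))
  have hlt : ∀ j j' i i', j < j' → e j i 0 < e j' i' 0 := fun j j' i i' hjj ↦
    hU j j' hjj _ (heU j i) _ (heU j' i')
  let C : Fin m → GeomCycle S k := fun i ↦
    ⟨fun j ↦ e j i, fun j ↦ hUS j (heU j i), fun j j' h ↦ by
      rcases lt_trichotomy j j' with h' | h' | h'
      · exact absurd (congrArg (fun p : Plane ↦ p 0) h) (hlt j j' i i h').ne
      · exact h'
      · exact absurd (congrArg (fun p : Plane ↦ p 0) h) (hlt j' j i i h').ne'⟩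
  have hC : ∀ i, IsCcw (C i).vertex := fun i j₁ j₂ j₃ h h' ↦
    hcup j₁ j₂ j₃ h h' _ (heU _ _) _ (heU _ _) _ (heU _ _)
  have hk3 : 3 ≤ k := by omega
  refine hasCrossingFamily_of_fun hk3 C
    (fun i ↦ GeomCycle.isSimpleConvex_of_isCcw hk3 (hC i)) fun i i' hii ↦ ?_
  have hfirst : (C i).vertex ⟨0, by omega⟩ ∉ region (C i').vertex := by
    intro hmem
    have := (hC i').eq_of_mem_region_of_le hk3 (α := 1) (β := 0) (i := ⟨0, by omega⟩) ?_ hmem ?_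
    · exact (hstrict _ i i' hii).ne (congrArg (fun p : Plane ↦ p 0) this)
    · intro j hj
      have := hlt ⟨0, by omega⟩ j i' i' (Fin.lt_def.2 (Nat.pos_of_ne_zero fun h ↦ hj (Fin.ext h)))
      simpa [C] using this
    · simpa [C] using (hstrict _ i i' hii).le
  have hlast : (C i').vertex ⟨k - 1, by omega⟩ ∉ region (C i).vertex := by
    intro hmem
    have := (hC i).eq_of_mem_region_of_le hk3 (α := -1) (β := 0) (i := ⟨k - 1, by omega⟩) ?_ hmem ?_
    · exact (hstrict _ i i' hii).ne (congrArg (fun p : Plane ↦ p 0) this).symm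
    · intro j hj
      have := hlt j ⟨k - 1, by omega⟩ i i
        (Fin.lt_def.2 (by have := j.2; rw [Ne, Fin.ext_iff] at hj; simp only at hj ⊢; omega))
      simpa [C] using this
    · simpa [C] using (hstrict _ i i' hii).le
  refine GeomCycle.cross_of_not_nested hS hk3 (hC i) (hC i') ?_ ?_ hfirst hlast
  · rw [GeomCycle.VertexDisjoint, Set.disjoint_left]
    rintro _ ⟨j, rfl⟩ ⟨j', h⟩
    rcases lt_trichotomy j j' with h' | h' | h'
    · exact absurd (congrArg (fun p : Plane ↦ p 0) h) (hlt j j' i i' h').ne'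
    · subst h'
      exact hii.ne' (he _ h)
    · exact absurd (congrArg (fun p : Plane ↦ p 0) h) (hlt j' j i' i h').ne
  -- The four chosen points alternate between the two cycles and form a convex quadrilateral; one
  -- diagonal lies in each region. This needs `4 ≤ k`.
  · set a : Fin k := ⟨0, by omega⟩
    set b : Fin k := ⟨1, by omega⟩
    set c : Fin k := ⟨2, by omega⟩
    set d : Fin k := ⟨3, by omega⟩
    have hab : a < b := by simp [a, b]
    have hbc : b < c := by simp [b, c]
    have hcd : c < d := by simp [c, d]
    have o1 := hcup a b c hab hbc _ (heU a i) _ (heU b i') _ (heU c i)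
    have o2 := hcup a c d (hab.trans hbc) hcd _ (heU a i) _ (heU c i) _ (heU d i')
    have o3 := hcup a b d hab (hbc.trans hcd) _ (heU a i) _ (heU b i') _ (heU d i')
    have o4 := hcup b c d hbc hcd _ (heU b i') _ (heU c i) _ (heU d i')
    refine (segments_meet (p := e a i) (q := e b i') (r := e c i) (s := e d i') ?_ o2 ?_ ?_).mono
      (Set.inter_subset_inter
        ((convex_region _).segment_subset ((hC i).mem_region a) ((hC i).mem_region c))
        ((convex_region _).segment_subset ((hC i').mem_region b) ((hC i').mem_region d)))
    · rw [orient_swap]; linarith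
    · rw [orient_rotate]; exact o3
    · rw [orient_swap]; linarith


/-! ### Caps with a point below -/

/-- Orientation is unchanged when ordinates are replaced by the heights `y - s x`; in these
coordinates the middle point is lower than both others. -/
lemma orient_pos_of_below_line {x y z : Plane} {s t : ℝ} (hxz : x 0 < z 0) (hzy : z 0 < y 0)
    (hx : t ≤ x 1 - s * x 0) (hy : t ≤ y 1 - s * y 0) (hz : z 1 - s * z 0 < t) :
    0 < orient x z y := by
  have : orient x z y = (z 0 - x 0) * ((y 1 - s * y 0) - (z 1 - s * z 0)) +
      ((x 1 - s * x 0) - (z 1 - s * z 0)) * (y 0 - z 0) := by unfold orient; ring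
  rw [this]
  exact add_pos (mul_pos (by linarith) (by linarith)) (mul_pos (by linarith) (by linarith))

/-- A cap `x w y` and a point `z` below its chord form a convex quadrilateral. -/
lemma isCcw_of_cap {x z y w : Plane} (hxz : x 0 < z 0) (hzy : z 0 < y 0) (hxw : x 0 < w 0)
    (hwy : w 0 < y 0) (hz : 0 < orient x z y) (hw : orient x w y < 0) :
    IsCcw ![x, z, y, w] := by
  have hxyw : 0 < orient x y w := by rw [orient_swap]; linarith
  -- Times the width `y 0 - x 0`, each remaining orientation is a positive combination of the two
  -- known ones, whatever the horizontal order of `z` and `w`.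
  have hxzw : 0 < orient x z w := by
    have h : orient x z w * (y 0 - x 0) =
        orient x z y * (w 0 - x 0) + orient x y w * (z 0 - x 0) := by unfold orient; ring
    refine pos_of_mul_pos_left (b := y 0 - x 0) ?_ (by linarith)
    rw [h]
    exact add_pos (mul_pos hz (by linarith)) (mul_pos hxyw (by linarith))
  have hzyw : 0 < orient z y w := by
    have h : orient z y w * (y 0 - x 0) =
        orient x y w * (y 0 - z 0) + orient x z y * (y 0 - w 0) := by unfold orient; ring
    refine pos_of_mul_pos_left (b := y 0 - x 0) ?_ (by linarith)
    rw [h]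
    exact add_pos (mul_pos hxyw (by linarith)) (mul_pos hz (by linarith))
  intro i j l hij hjl
  fin_cases i <;> fin_cases j <;> fin_cases l <;> simp at hij hjl ⊢ <;> assumption

/-- The chord is written as a graph so that two chords can be compared at one abscissa. -/
lemma exists_line {x y : Plane} (h : x 0 < y 0) :
    ∃ a b : ℝ, (∀ u, x 0 ≤ u → u ≤ y 0 → !₂[u, a * u + b] ∈ segment ℝ x y) ∧
      ∀ z, 0 < orient x z y → z 1 < a * z 0 + b := by
  have hne : y 0 - x 0 ≠ 0 := by linarith
  refine ⟨(y 1 - x 1) / (y 0 - x 0), x 1 - (y 1 - x 1) / (y 0 - x 0) * x 0, fun u h1 h2 ↦ ?_,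
    fun z hz ↦ ?_⟩
  · refine ⟨(y 0 - u) / (y 0 - x 0), (u - x 0) / (y 0 - x 0), div_nonneg (by linarith)
      (by linarith), div_nonneg (by linarith) (by linarith), ?_, plane_ext ?_ ?_⟩
    · field_simp; ring
    · simp; field_simp; ring
    · simp; field_simp; ring
  · unfold orient at hz
    have : (y 1 - x 1) / (y 0 - x 0) * z 0 + (x 1 - (y 1 - x 1) / (y 0 - x 0) * x 0) - z 1 =
        ((z 0 - x 0) * (y 1 - x 1) - (z 1 - x 1) * (y 0 - x 0)) / (y 0 - x 0) := by
      field_simp; ring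
    have h3 := div_pos hz (sub_pos.2 h)
    linarith

lemma Convex.mem_of_vertical {K : Set Plane} (hK : Convex ℝ K) {u l c h : ℝ} (hl : !₂[u, l] ∈ K)
    (hh : !₂[u, h] ∈ K) (hlc : l ≤ c) (hch : c ≤ h) : !₂[u, c] ∈ K := by
  rcases hlc.eq_or_lt with rfl | hlc
  · exact hl
  refine hK.segment_subset hl hh ⟨(h - c) / (h - l), (c - l) / (h - l),
    div_nonneg (by linarith) (by linarith), div_nonneg (by linarith) (by linarith), ?_,
    plane_ext ?_ ?_⟩
  · rw [← add_div, div_eq_one_iff_eq (by linarith)]; ring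
  all_goals
    have : h - l ≠ 0 := by linarith
    simp; field_simp; ring

/-- Compare the two chords above `z` and above `z'`. If at `z` the chord of `K'` is not above that
of `K`, its point there lies between `z` and the chord of `K`, hence in `K`; symmetrically at `z'`.
Otherwise the chords change order between `z` and `z'` and so intersect. -/
lemma triangles_meet {K K' : Set Plane} (hK : Convex ℝ K) (hK' : Convex ℝ K')
    {x y z x' y' z' : Plane} (hx : x ∈ K) (hy : y ∈ K) (hz : z ∈ K) (hx' : x' ∈ K')
    (hy' : y' ∈ K') (hz' : z' ∈ K') (h1 : x 0 < z 0) (h2 : z 0 < y 0) (h3 : x' 0 < z 0)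
    (h4 : z 0 < y' 0) (h1' : x 0 < z' 0) (h2' : z' 0 < y 0) (h3' : x' 0 < z' 0)
    (h4' : z' 0 < y' 0) (o2 : 0 < orient x' z y')
    (o3 : 0 < orient x z' y) : (K ∩ K').Nonempty := by
  obtain ⟨a, b, hab, hlt⟩ := exists_line (h1.trans h2)
  obtain ⟨a', b', hab', hlt'⟩ := exists_line (h3.trans h4)
  have sK : ∀ u, x 0 ≤ u → u ≤ y 0 → !₂[u, a * u + b] ∈ K :=
    fun u hu hu' ↦ hK.segment_subset hx hy (hab u hu hu')
  have sK' : ∀ u, x' 0 ≤ u → u ≤ y' 0 → !₂[u, a' * u + b'] ∈ K' :=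
    fun u hu hu' ↦ hK'.segment_subset hx' hy' (hab' u hu hu')
  have ez : !₂[z 0, z 1] = z := plane_ext (by simp) (by simp)
  have ez' : !₂[z' 0, z' 1] = z' := plane_ext (by simp) (by simp)
  rcases le_or_gt (a' * z 0 + b') (a * z 0 + b) with c1 | c1
  · exact ⟨_, hK.mem_of_vertical (ez.symm ▸ hz) (sK _ h1.le h2.le) (hlt' z o2).le c1,
      sK' _ h3.le h4.le⟩
  rcases le_or_gt (a * z' 0 + b) (a' * z' 0 + b') with c2 | c2
  · exact ⟨_, sK _ h1'.le h2'.le,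
      hK'.mem_of_vertical (ez'.symm ▸ hz') (sK' _ h3'.le h4'.le) (hlt z' o3).le c2⟩
  set D := a' * z 0 + b' - (a * z 0 + b)
  set D' := a * z' 0 + b - (a' * z' 0 + b')
  have hD : 0 < D := sub_pos.2 c1
  have hD' : 0 < D' := sub_pos.2 c2
  have hne : D + D' ≠ 0 := by linarith
  -- The zero of the affine difference of the chords, by interpolation between its values `D` and
  -- `-D'`.
  set u := D' / (D + D') * z 0 + D / (D + D') * z' 0 with hu
  have hw : D' / (D + D') + D / (D + D') = 1 := by field_simp; ring
  have hw1 : 0 < D' / (D + D') := by positivity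
  have hw2 : 0 < D / (D + D') := by positivity
  have low : ∀ c : ℝ, c < z 0 → c < z' 0 → c ≤ u := fun c e1 e2 ↦ by
    calc c = D' / (D + D') * c + D / (D + D') * c := by rw [← add_mul, hw, one_mul]
      _ ≤ u := by rw [hu]; gcongr
  have high : ∀ c : ℝ, z 0 < c → z' 0 < c → u ≤ c := fun c e1 e2 ↦ by
    calc u ≤ D' / (D + D') * c + D / (D + D') * c := by rw [hu]; gcongr
      _ = c := by rw [← add_mul, hw, one_mul]
  have heq : a * u + b = a' * u + b' := by
    rw [hu]; field_simp; simp only [D, D']; ring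
  refine ⟨_, sK u (low _ h1 h1') (high _ h2 h2'), ?_⟩
  rw [heq]
  exact sK' u (low _ h3 h3') (high _ h4 h4')

/-- The triple `x w y` is a cap that starts in `X` and ends in `Y`. -/
def IsCapBetween (X Y : Finset Plane) (τ : Plane × Plane × Plane) : Prop :=
  τ.1 ∈ X ∧ τ.2.2 ∈ Y ∧ (τ.2.1 ∈ X ∨ τ.2.1 ∈ Y) ∧ τ.1 0 < τ.2.1 0 ∧ τ.2.1 0 < τ.2.2 0 ∧
    orient τ.1 τ.2.1 τ.2.2 < 0

/-- The set of vertices of a triple. -/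
def tripleVerts (τ : Plane × Plane × Plane) : Set Plane := {τ.1, τ.2.1, τ.2.2}

/-- Disjoint caps, together with points below their chords, yield a crossing family of
quadrilaterals. -/
lemma hasCrossingFamily_of_caps {S : Finset Plane} (hS : OrientNonzero S)
    {m : ℕ} {X Y Z : Finset Plane} (hXS : X ⊆ S)
    (hYS : Y ⊆ S) (hZS : Z ⊆ S) (hXZ : ∀ x ∈ X, ∀ z ∈ Z, x 0 < z 0)
    (hZY : ∀ z ∈ Z, ∀ y ∈ Y, z 0 < y 0) {s t : ℝ} (hX : ∀ x ∈ X, t ≤ x 1 - s * x 0)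
    (hY : ∀ y ∈ Y, t ≤ y 1 - s * y 0) (hZ : ∀ z ∈ Z, z 1 - s * z 0 < t)
    (T : Finset (Plane × Plane × Plane)) (hT : ∀ τ ∈ T, IsCapBetween X Y τ)
    (hdisj : ∀ τ ∈ T, ∀ τ' ∈ T, τ ≠ τ' → Disjoint (tripleVerts τ) (tripleVerts τ'))
    (hmT : m ≤ T.card) (hmZ : m ≤ Z.card) : HasCrossingFamily S 4 m := by
  obtain ⟨e, he, heT, hemono⟩ := exists_sorted_enum T (fun τ ↦ τ.1 0) hmT
  -- The key is negated so that larger indices are lower. Of two quadrilaterals the earlier then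
  -- reaches further left and the later reaches further down, relative to slope `s`.
  obtain ⟨z, hz, hzZ, hzmono⟩ := exists_sorted_enum Z (fun z ↦ -(z 1 - s * z 0)) hmZ
  have hcap := fun i ↦ hT _ (heT i)
  have o : ∀ i j, 0 < orient (e i).1 (z j) (e i).2.2 := fun i j ↦
    orient_pos_of_below_line (hXZ _ (hcap i).1 _ (hzZ j)) (hZY _ (hzZ j) _ (hcap i).2.1)
      (hX _ (hcap i).1) (hY _ (hcap i).2.1) (hZ _ (hzZ j))
  have hccw : ∀ i, IsCcw ![(e i).1, z i, (e i).2.2, (e i).2.1] := fun i ↦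
    isCcw_of_cap (hXZ _ (hcap i).1 _ (hzZ i)) (hZY _ (hzZ i) _ (hcap i).2.1) (hcap i).2.2.2.1
      (hcap i).2.2.2.2.1 (o i i) (hcap i).2.2.2.2.2
  have hzw : ∀ i j, z j ≠ (e i).2.1 := by
    intro i j h
    rcases (hcap i).2.2.1 with h' | h'
    · exact (hXZ _ h' _ (hzZ j)).ne (by rw [h])
    · exact (hZY _ (hzZ j) _ h').ne (by rw [h])
  have hzx : ∀ i j, z j ≠ (e i).1 := fun i j h ↦ (hXZ _ (hcap i).1 _ (hzZ j)).ne (by rw [h])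
  have hzy : ∀ i j, z j ≠ (e i).2.2 := fun i j h ↦ (hZY _ (hzZ j) _ (hcap i).2.1).ne (by rw [h])
  have hinj : ∀ i, Function.Injective ![(e i).1, z i, (e i).2.2, (e i).2.1] := by
    intro i
    have a1 : (e i).1 ≠ (e i).2.1 := fun h ↦ (hcap i).2.2.2.1.ne (by rw [h])
    have a2 : (e i).2.1 ≠ (e i).2.2 := fun h ↦ (hcap i).2.2.2.2.1.ne (by rw [h])
    have a3 : (e i).1 ≠ (e i).2.2 := fun h ↦
      ((hcap i).2.2.2.1.trans (hcap i).2.2.2.2.1).ne (by rw [h])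
    intro a b hab
    fin_cases a <;> fin_cases b <;>
      simp [a1, a2, a3, a1.symm, a2.symm, a3.symm, hzw i i, hzx i i, hzy i i, (hzw i i).symm,
        (hzx i i).symm, (hzy i i).symm] at hab ⊢
  let C : Fin m → GeomCycle S 4 := fun i ↦
    ⟨![(e i).1, z i, (e i).2.2, (e i).2.1], fun j ↦ by
      fin_cases j
      · exact hXS (hcap i).1
      · exact hZS (hzZ i)
      · exact hYS (hcap i).2.1
      · exact (hcap i).2.2.1.elim (fun h ↦ hXS h) (fun h ↦ hYS h), hinj i⟩
  have hne : ∀ i j, i ≠ j → Disjoint (tripleVerts (e i)) (tripleVerts (e j)) := fun i j hij ↦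
    hdisj _ (heT i) _ (heT j) (he.ne hij)
  have hrange : ∀ i, Set.range (C i).vertex = insert (z i) (tripleVerts (e i)) := by
    intro i
    ext p
    simp only [Set.mem_range, Fin.exists_fin_succ, tripleVerts, Set.mem_insert_iff,
      Set.mem_singleton_iff]
    simp [C, eq_comm]
    tauto
  refine hasCrossingFamily_of_fun (by norm_num) C
    (fun i ↦ GeomCycle.isSimpleConvex_of_isCcw (by norm_num) (hccw i)) fun i j hij ↦ ?_
  have hfirst : (C i).vertex 0 ∉ region (C j).vertex := by
    intro hmem
    have hlt : (e i).1 0 ≤ (e j).1 0 := hemono hij.le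
    have := (hccw j).eq_of_mem_region_of_le (by norm_num) (α := 1) (β := 0) (i := 0) ?_ hmem ?_
    · have h' : (e i).1 = (e j).1 := this
      have h1 : (e i).1 ∈ tripleVerts (e i) := by simp [tripleVerts]
      have h2 : (e i).1 ∈ tripleVerts (e j) := by rw [h']; simp [tripleVerts]
      exact Set.disjoint_left.1 (hne i j hij.ne) h1 h2
    · intro l hl
      fin_cases l
      · exact absurd rfl hl
      · simpa using hXZ _ (hcap j).1 _ (hzZ j)
      · simpa using (hcap j).2.2.2.1.trans (hcap j).2.2.2.2.1
      · simpa using (hcap j).2.2.2.1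
    · simpa [C] using hlt
  have hlow : (C j).vertex 1 ∉ region (C i).vertex := by
    intro hmem
    have hle : -(z i 1 - s * z i 0) ≤ -(z j 1 - s * z j 0) := hzmono hij.le
    have := (hccw i).eq_of_mem_region_of_le (by norm_num) (α := -s) (β := 1) (i := 1) ?_ hmem ?_
    · exact hij.ne' (hz this)
    · have hzi := hZ _ (hzZ i)
      intro l hl
      fin_cases l
      · have := hX _ (hcap i).1
        simp; linarith
      · exact absurd rfl hl
      · have := hY _ (hcap i).2.1
        simp; linarith
      · have : t ≤ (e i).2.1 1 - s * (e i).2.1 0 := (hcap i).2.2.1.elim (hX _) (hY _)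
        simp; linarith
    · simp [C]; linarith
  refine GeomCycle.cross_of_not_nested hS (by norm_num) (hccw i) (hccw j) ?_ ?_ hfirst hlow
  · rw [GeomCycle.VertexDisjoint, hrange, hrange, Set.disjoint_insert_left,
      Set.disjoint_insert_right]
    refine ⟨?_, ?_, hne i j hij.ne⟩
    · simp only [tripleVerts, Set.mem_insert_iff, Set.mem_singleton_iff, not_or]
      exact ⟨hz.ne hij.ne, hzx _ _, hzw _ _, hzy _ _⟩
    · simp only [tripleVerts, Set.mem_insert_iff, Set.mem_singleton_iff, not_or]
      exact ⟨hzx _ _, hzw _ _, hzy _ _⟩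
  · exact triangles_meet (convex_region _) (convex_region _) ((hccw i).mem_region 0)
      ((hccw i).mem_region 2) ((hccw i).mem_region 1) ((hccw j).mem_region 0)
      ((hccw j).mem_region 2) ((hccw j).mem_region 1)
      (hXZ _ (hcap i).1 _ (hzZ i)) (hZY _ (hzZ i) _ (hcap i).2.1)
      (hXZ _ (hcap j).1 _ (hzZ i)) (hZY _ (hzZ i) _ (hcap j).2.1)
      (hXZ _ (hcap i).1 _ (hzZ j)) (hZY _ (hzZ j) _ (hcap i).2.1)
      (hXZ _ (hcap j).1 _ (hzZ j)) (hZY _ (hzZ j) _ (hcap j).2.1)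
      (o j i) (o i j)


/-! ### Cutting two separated sets by a line -/

/-- The `p`-th smallest value of `y - s x` on a finite set depends continuously on `s`. -/
lemma exists_continuous_order_statistic {A : Finset Plane} {p : ℕ} (hp : 0 < p)
    (hpA : p ≤ A.card) :
    ∃ α : ℝ → ℝ, Continuous α ∧ ∀ s, (∃ a ∈ A, a 1 - s * a 0 = α s) ∧
      p ≤ {a ∈ A | a 1 - s * a 0 ≤ α s}.card ∧ {a ∈ A | a 1 - s * a 0 < α s}.card < p := by
  classical
  have : Nonempty (Fin p) := ⟨⟨0, hp⟩⟩
  have hne : (Finset.univ : Finset (Fin p)).Nonempty := Finset.univ_nonempty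
  have : Nonempty (Fin p ↪ A) := by
    rw [Function.Embedding.nonempty_iff_card_le]; simpa using hpA
  have hne' : (Finset.univ : Finset (Fin p ↪ A)).Nonempty := Finset.univ_nonempty
  -- The `p`-th smallest value is the minimum, over choices of `p` points, of the largest value
  -- chosen: a finite min–max of affine functions of `s`.
  let f : (Fin p ↪ A) → ℝ → ℝ := fun g s ↦
    Finset.univ.sup' hne fun i ↦ (g i : Plane) 1 - s * (g i : Plane) 0
  refine ⟨fun s ↦ Finset.univ.inf' hne' fun g ↦ f g s, ?_, fun s ↦ ?_⟩
  · exact Continuous.finset_inf'_apply hne' fun g _ ↦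
      Continuous.finset_sup'_apply hne fun i _ ↦ by fun_prop
  obtain ⟨g, -, hg⟩ := Finset.exists_mem_eq_inf' hne' fun g ↦ f g s
  obtain ⟨i, -, hi⟩ := Finset.exists_mem_eq_sup' hne
    fun i ↦ (g i : Plane) 1 - s * (g i : Plane) 0
  refine ⟨⟨g i, (g i).2, (hi.symm.trans hg.symm)⟩, ?_, ?_⟩
  · have hinj : Function.Injective fun i ↦ (g i : Plane) := Subtype.val_injective.comp g.injective
    calc p = (Finset.univ.image fun i ↦ (g i : Plane)).card := by
          rw [Finset.card_image_of_injective _ hinj]; simp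
      _ ≤ _ := by
          refine Finset.card_le_card fun x hx ↦ ?_
          obtain ⟨j, -, rfl⟩ := Finset.mem_image.1 hx
          refine Finset.mem_filter.2 ⟨(g j).2, ?_⟩
          exact (Finset.le_sup' (fun i ↦ (g i : Plane) 1 - s * (g i : Plane) 0)
            (Finset.mem_univ j)).trans hg.ge
  · by_contra! hcard
    obtain ⟨e⟩ : Nonempty
        (Fin p ↪ ({a ∈ A | a 1 - s * a 0 < Finset.univ.inf' hne' fun g ↦ f g s} :
          Finset Plane)) := by
      rw [Function.Embedding.nonempty_iff_card_le]; simpa using hcard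
    let e' : Fin p ↪ A := ⟨fun i ↦ ⟨e i, (Finset.mem_filter.1 (e i).2).1⟩, fun i j hij ↦
      e.injective (Subtype.ext (congrArg (fun x : A ↦ (x : Plane)) hij))⟩
    have h1 : (Finset.univ.inf' hne' fun g ↦ f g s) ≤ f e' s :=
      Finset.inf'_le (fun g ↦ f g s) (Finset.mem_univ e')
    obtain ⟨j, -, hj⟩ := Finset.exists_mem_eq_sup' hne
      fun i ↦ (e' i : Plane) 1 - s * (e' i : Plane) 0
    have h2 := (Finset.mem_filter.1 (e j).2).2
    have h3 : f e' s = (e j : Plane) 1 - s * (e j : Plane) 0 := hj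
    linarith

/-- Two finite sets separated by a vertical line have a common halving line. -/
lemma exists_halving_line {A B : Finset Plane} (hAB : ∀ a ∈ A, ∀ b ∈ B, a 0 < b 0) {p : ℕ}
    (hp : 0 < p) (hA : 2 * p ≤ A.card) (hB : 2 * p ≤ B.card) :
    ∃ s t : ℝ, (∃ a ∈ A, a 1 - s * a 0 = t) ∧ (∃ b ∈ B, b 1 - s * b 0 = t) ∧
      p ≤ {a ∈ A | a 1 - s * a 0 ≤ t}.card ∧ p ≤ {b ∈ B | b 1 - s * b 0 ≤ t}.card ∧
      p ≤ {a ∈ A | t ≤ a 1 - s * a 0}.card ∧ p ≤ {b ∈ B | t ≤ b 1 - s * b 0}.card := by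
  obtain ⟨α, hα, hα'⟩ := exists_continuous_order_statistic hp (by omega : p ≤ A.card)
  obtain ⟨β, hβ, hβ'⟩ := exists_continuous_order_statistic hp (by omega : p ≤ B.card)
  have hup : ∀ (D : Finset Plane) (s t : ℝ), 2 * p ≤ D.card →
      {a ∈ D | a 1 - s * a 0 < t}.card < p → p ≤ {a ∈ D | t ≤ a 1 - s * a 0}.card := by
    intro D s t h1 h2
    have := Finset.card_filter_add_card_filter_not (s := D) (fun a ↦ a 1 - s * a 0 < t)
    simp only [not_lt] at this
    omega
  -- `M` bounds every slope from `A` to `B`. At `s = -M` no value on `A` exceeds one on `B`, at `s =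
  -- M` the reverse holds, so the two order statistics agree somewhere in between.
  obtain ⟨M, hM⟩ : ∃ M : ℝ, ∀ a ∈ A, ∀ b ∈ B, |(b 1 - a 1) / (b 0 - a 0)| ≤ M := by
    obtain ⟨M, hM⟩ := ((A ×ˢ B).image
      fun x ↦ |(x.2 1 - x.1 1) / (x.2 0 - x.1 0)|).bddAbove
    exact ⟨M, fun a ha b hb ↦
      hM (Finset.mem_image_of_mem _ (Finset.mk_mem_product ha hb : (a, b) ∈ A ×ˢ B))⟩
  obtain ⟨s, hs⟩ : (0 : ℝ) ∈ Set.range fun s ↦ α s - β s := by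
    refine mem_range_of_exists_le_of_exists_ge (hα.sub hβ) ⟨-M, ?_⟩ ⟨M, ?_⟩
    · obtain ⟨a, ha, ha'⟩ := (hα' (-M)).1
      obtain ⟨b, hb, hb'⟩ := (hβ' (-M)).1
      have h0 := sub_pos.2 (hAB a ha b hb)
      have := (le_div_iff₀ h0).1 (abs_le.1 (hM a ha b hb)).1
      rw [← ha', ← hb']; linarith
    · obtain ⟨a, ha, ha'⟩ := (hα' M).1
      obtain ⟨b, hb, hb'⟩ := (hβ' M).1
      have h0 := sub_pos.2 (hAB a ha b hb)
      have := (div_le_iff₀ h0).1 (abs_le.1 (hM a ha b hb)).2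
      rw [← ha', ← hb']; linarith
  have hs' : β s = α s := (sub_eq_zero.1 hs).symm
  obtain ⟨a1, a2, a3⟩ := hα' s
  obtain ⟨b1, b2, b3⟩ := hβ' s
  rw [hs'] at b1 b2 b3
  exact ⟨s, α s, a1, b1, a2, b2, hup A s _ hA a3, hup B s _ hB b3⟩

/-- Three sets, one to the right of the other, have large subsets such that the outer two lie on one
side of a line and the middle one on the other side. -/
lemma exists_line_separating_middle {S A B C : Finset Plane} (hS : OrientNonzero S) (hAS : A ⊆ S)
    (hBS : B ⊆ S) (hCS : C ⊆ S) (hAC : ∀ a ∈ A, ∀ c ∈ C, a 0 < c 0)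
    (hCB : ∀ c ∈ C, ∀ b ∈ B, c 0 < b 0) (hAB : ∀ a ∈ A, ∀ b ∈ B, a 0 < b 0) {p q : ℕ}
    (hp : 0 < p) (hA : 2 * p ≤ A.card) (hB : 2 * p ≤ B.card) (hC : 2 * q ≤ C.card) :
    ∃ s t : ℝ, ∃ A' ⊆ A, ∃ B' ⊆ B, ∃ C' ⊆ C, p ≤ A'.card ∧ p ≤ B'.card ∧ q ≤ C'.card ∧
      (((∀ a ∈ A', t ≤ a 1 - s * a 0) ∧ (∀ b ∈ B', t ≤ b 1 - s * b 0) ∧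
        ∀ c ∈ C', c 1 - s * c 0 < t) ∨
      ((∀ a ∈ A', a 1 - s * a 0 ≤ t) ∧ (∀ b ∈ B', b 1 - s * b 0 ≤ t) ∧
        ∀ c ∈ C', t < c 1 - s * c 0)) := by
  obtain ⟨s, t, ⟨a, ha, hat⟩, ⟨b, hb, hbt⟩, h1, h2, h3, h4⟩ := exists_halving_line hAB hp hA hB
  -- The halving line passes through a point of `A` and one of `B`, so general position keeps `C`
  -- off it and one open side contains `q` points of `C`.
  have hoff : ∀ c ∈ C, c 1 - s * c 0 ≠ t := by
    intro c hc hct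
    have hac := hAC a ha c hc
    have hcb := hCB c hc b hb
    refine hS a (hAS ha) c (hCS hc) b (hBS hb) (fun h ↦ hac.ne (by rw [h]))
      (fun h ↦ hcb.ne (by rw [h])) (fun h ↦ (hac.trans hcb).ne (by rw [h])) ?_
    unfold orient
    linear_combination (c 0 - a 0) * (hbt - hct) + (c 0 - b 0) * (hct - hat)
  have hcard := Finset.card_filter_add_card_filter_not (s := C) (fun c ↦ c 1 - s * c 0 < t)
  simp only [not_lt] at hcard
  rcases le_or_gt q {c ∈ C | c 1 - s * c 0 < t}.card with hq | hq
  · exact ⟨s, t, _, Finset.filter_subset _ _, _, Finset.filter_subset _ _, _,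
      Finset.filter_subset _ _, h3, h4, hq, Or.inl ⟨fun a ha ↦ (Finset.mem_filter.1 ha).2,
        fun b hb ↦ (Finset.mem_filter.1 hb).2, fun c hc ↦ (Finset.mem_filter.1 hc).2⟩⟩
  · exact ⟨s, t, _, Finset.filter_subset _ _, _, Finset.filter_subset _ _, _,
      Finset.filter_subset _ _, h1, h2, (by omega : q ≤ {c ∈ C | t ≤ c 1 - s * c 0}.card),
      Or.inr ⟨fun a ha ↦ (Finset.mem_filter.1 ha).2, fun b hb ↦ (Finset.mem_filter.1 hb).2,
        fun c hc ↦ lt_of_le_of_ne (Finset.mem_filter.1 hc).2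
          (hoff c (Finset.mem_filter.1 hc).1).symm⟩⟩

/-- The `a` leftmost points of a finite set with distinct abscissas. -/
lemma exists_leftmost [DecidableEq Plane] {S : Finset Plane}
    (hx : ∀ p ∈ S, ∀ q ∈ S, p 0 = q 0 → p = q) {a : ℕ} (ha : a ≤ S.card) :
    ∃ T ⊆ S, T.card = a ∧ ∀ p ∈ T, ∀ q ∈ S \ T, p 0 < q 0 := by
  induction a with
  | zero => exact ⟨∅, by simp, rfl, by simp⟩
  | succ a ih =>
    obtain ⟨T, hTS, hT, hlt⟩ := ih (by omega)
    have hne : (S \ T).Nonempty := by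
      rw [← Finset.card_pos, Finset.card_sdiff_of_subset hTS]; omega
    obtain ⟨r, hr, hmin⟩ := Finset.exists_min_image (S \ T) (fun p ↦ p 0) hne
    obtain ⟨hrS, hrT⟩ := Finset.mem_sdiff.1 hr
    refine ⟨insert r T, Finset.insert_subset hrS hTS, by rw [Finset.card_insert_of_notMem hrT, hT],
      fun p hp q hq ↦ ?_⟩
    simp only [Finset.mem_sdiff, Finset.mem_insert, not_or] at hq
    have hq' : q ∈ S \ T := Finset.mem_sdiff.2 ⟨hq.1, hq.2.2⟩
    rcases Finset.mem_insert.1 hp with rfl | hp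
    · exact lt_of_le_of_ne (hmin q hq') fun h ↦ hq.2.1 (hx _ hrS _ hq.1 h).symm
    · exact hlt p hp q hq'

/-! ### Quadrilaterals -/

/-- Either there are `r` disjoint caps between `X` and `Y`, or after deleting few points no cap is
left. -/
lemma exists_disjoint_caps_or_no_cap [DecidableEq Plane] (r : ℕ) (X Y : Finset Plane)
    (hXY : ∀ x ∈ X, ∀ y ∈ Y, x 0 < y 0) :
    (∃ T : Finset (Plane × Plane × Plane), T.card = r ∧ (∀ τ ∈ T, IsCapBetween X Y τ) ∧
      ∀ τ ∈ T, ∀ τ' ∈ T, τ ≠ τ' → Disjoint (tripleVerts τ) (tripleVerts τ')) ∨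
    ∃ X' ⊆ X, ∃ Y' ⊆ Y, X.card ≤ X'.card + 2 * r ∧ Y.card ≤ Y'.card + 2 * r ∧
      ∀ τ, ¬ IsCapBetween X' Y' τ := by
  classical
  induction r generalizing X Y with
  | zero => exact Or.inl ⟨∅, by simp⟩
  | succ r ih =>
    by_cases h : ∃ τ, IsCapBetween X Y τ
    · obtain ⟨⟨x, w, y⟩, hτ⟩ := h
      have hτ' := hτ
      obtain ⟨hxX, hyY, hw, -⟩ := hτ
      simp only at hxX hyY hw
      have hnot : ∀ p ∈ X, p ∉ Y := fun p hp hp' ↦ (hXY p hp p hp').false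
      set V : Finset Plane := {x, w, y} with hV
      -- The caps are chosen greedily; one cap has an end on each side and so takes at most two
      -- points from either.
      have hcX : X.card ≤ (X \ V).card + 2 := by
        have h1 : X \ V = X \ {x, w} := by
          ext p; simp only [hV, Finset.mem_sdiff, Finset.mem_insert, Finset.mem_singleton]
          constructor
          · rintro ⟨h1, h2⟩; exact ⟨h1, by tauto⟩
          · rintro ⟨h1, h2⟩
            exact ⟨h1, by rintro (h | h | rfl) <;> [tauto; tauto; exact hnot _ h1 hyY]⟩
        have h2 := Finset.le_card_sdiff {x, w} X
        have h3 := Finset.card_le_two (a := x) (b := w)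
        rw [h1]; omega
      have hcY : Y.card ≤ (Y \ V).card + 2 := by
        have h1 : Y \ V = Y \ {w, y} := by
          ext p; simp only [hV, Finset.mem_sdiff, Finset.mem_insert, Finset.mem_singleton]
          constructor
          · rintro ⟨h1, h2⟩; exact ⟨h1, by tauto⟩
          · rintro ⟨h1, h2⟩
            exact ⟨h1, by rintro (rfl | h | h) <;> [exact hnot _ hxX h1; tauto; tauto]⟩
        have h2 := Finset.le_card_sdiff {w, y} Y
        have h3 := Finset.card_le_two (a := w) (b := y)
        rw [h1]; omega
      rcases ih (X \ V) (Y \ V) fun a ha b hb ↦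
        hXY a (Finset.mem_sdiff.1 ha).1 b (Finset.mem_sdiff.1 hb).1 with
        ⟨T, hTc, hT, hd⟩ | ⟨X', hX', Y', hY', hcX', hcY', hno⟩
      · left
        have hnew : ∀ τ ∈ T, Disjoint (tripleVerts (x, w, y)) (tripleVerts τ) := by
          intro τ hτT
          obtain ⟨g1, g2, g3, -⟩ := hT τ hτT
          have hVmem : ∀ p, p ∈ tripleVerts τ → p ∉ V := by
            rintro p (rfl | rfl | rfl)
            · exact (Finset.mem_sdiff.1 g1).2
            · exact g3.elim (fun h ↦ (Finset.mem_sdiff.1 h).2) fun h ↦ (Finset.mem_sdiff.1 h).2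
            · exact (Finset.mem_sdiff.1 g2).2
          rw [Set.disjoint_left]
          intro p hp hp'
          refine hVmem p hp' ?_
          simpa [hV, tripleVerts] using hp
        have hnotin : (x, w, y) ∉ T := by
          intro h
          have hxV : x ∈ tripleVerts (x, w, y) := by simp [tripleVerts]
          exact Set.disjoint_left.1 (hnew _ h) hxV hxV
        refine ⟨insert (x, w, y) T, by rw [Finset.card_insert_of_notMem hnotin, hTc], ?_, ?_⟩
        · intro τ hτT
          rcases Finset.mem_insert.1 hτT with rfl | hτT
          · exact hτ'
          · obtain ⟨g1, g2, g3, g4⟩ := hT τ hτT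
            exact ⟨(Finset.mem_sdiff.1 g1).1, (Finset.mem_sdiff.1 g2).1,
              g3.imp (fun h ↦ (Finset.mem_sdiff.1 h).1) (fun h ↦ (Finset.mem_sdiff.1 h).1), g4⟩
        · intro τ h1 τ' h2 hne
          rcases Finset.mem_insert.1 h1 with rfl | h1 <;> rcases Finset.mem_insert.1 h2 with rfl | h2
          · exact absurd rfl hne
          · exact hnew _ h2
          · exact (hnew _ h1).symm
          · exact hd _ h1 _ h2 hne
      · right
        exact ⟨X', hX'.trans Finset.sdiff_subset, Y', hY'.trans Finset.sdiff_subset, by omega,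
          by omega, hno⟩
    · exact Or.inr ⟨X, subset_rfl, Y, subset_rfl, by omega, by omega, fun τ hτ ↦ h ⟨τ, hτ⟩⟩

/-- Two large sets above a line with a third set between them and below the line yield a crossing
family of quadrilaterals. -/
lemma hasCrossingFamily_four_of_below {S : Finset Plane} (hS : OrientNonzero S)
    (hx : ∀ p ∈ S, ∀ q ∈ S, p 0 = q 0 → p = q) {m : ℕ} {X Y Z : Finset Plane} (hXS : X ⊆ S)
    (hYS : Y ⊆ S) (hZS : Z ⊆ S) (hXZ : ∀ x ∈ X, ∀ z ∈ Z, x 0 < z 0)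
    (hZY : ∀ z ∈ Z, ∀ y ∈ Y, z 0 < y 0) (hXY : ∀ x ∈ X, ∀ y ∈ Y, x 0 < y 0) {s t : ℝ}
    (hX : ∀ x ∈ X, t ≤ x 1 - s * x 0) (hY : ∀ y ∈ Y, t ≤ y 1 - s * y 0)
    (hZ : ∀ z ∈ Z, z 1 - s * z 0 < t) (hmX : 4 * m ≤ X.card) (hmY : 4 * m ≤ Y.card)
    (hmZ : m ≤ Z.card) : HasCrossingFamily S 4 m := by
  classical
  rcases exists_disjoint_caps_or_no_cap m X Y hXY with
    ⟨T, hTc, hT, hd⟩ | ⟨X', hX', Y', hY', hcX, hcY, hno⟩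
  · exact hasCrossingFamily_of_caps hS hXS hYS hZS hXZ hZY hX hY hZ T hT hd hTc.ge hmZ
  have hX'S := hX'.trans hXS
  have hY'S := hY'.trans hYS
  have hcup : ∀ a b c, a ∈ X' → c ∈ Y' → (b ∈ X' ∨ b ∈ Y') → a 0 < b 0 → b 0 < c 0 →
      0 < orient a b c := by
    intro a b c ha hc hb hab hbc
    refine lt_of_le_of_ne (le_of_not_gt fun h ↦ hno (a, b, c) ⟨ha, hc, hb, hab, hbc, h⟩) ?_
    exact (hS a (hX'S ha) b (hb.elim (fun h ↦ hX'S h) fun h ↦ hY'S h) c (hY'S hc)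
      (fun h ↦ hab.ne (by rw [h])) (fun h ↦ hbc.ne (by rw [h]))
      (fun h ↦ (hab.trans hbc).ne (by rw [h]))).symm
  obtain ⟨X₁, hX₁, hX₁c, hX₁lt⟩ := exists_leftmost
    (fun p hp q hq ↦ hx p (hX'S hp) q (hX'S hq)) (by omega : m ≤ X'.card)
  obtain ⟨Y₁, hY₁, hY₁c, hY₁lt⟩ := exists_leftmost
    (fun p hp q hq ↦ hx p (hY'S hp) q (hY'S hq)) (by omega : m ≤ Y'.card)
  have hX₂c := Finset.card_sdiff_of_subset hX₁
  have hY₂c := Finset.card_sdiff_of_subset hY₁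
  have hX₂ : X' \ X₁ ⊆ X' := Finset.sdiff_subset
  have hY₂ : Y' \ Y₁ ⊆ Y' := Finset.sdiff_subset
  have hlt : ∀ x ∈ X', ∀ y ∈ Y', x 0 < y 0 := fun x h y h' ↦ hXY x (hX' h) y (hY' h')
  -- At least `2 * m` points remain on each side, giving four clusters of size at least `m`. Any
  -- three of the four begin in `X'` and end in `Y'`, so `hcup` applies to all transversals.
  refine hasCrossingFamily_of_cup_clusters hS hx le_rfl ![X₁, X' \ X₁, Y₁, Y' \ Y₁] ?_ ?_ ?_ ?_
  · intro j
    fin_cases j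
    · exact hX₁.trans hX'S
    · exact hX₂.trans hX'S
    · exact hY₁.trans hY'S
    · exact hY₂.trans hY'S
  · intro j
    fin_cases j <;> simp <;> omega
  · intro j j' hjj p hp q hq
    fin_cases j <;> fin_cases j' <;> simp at hjj hp hq
    · exact hX₁lt p hp q (by simpa using hq)
    · exact hlt p (hX₁ hp) q (hY₁ hq)
    · exact hlt p (hX₁ hp) q hq.1
    · exact hlt p hp.1 q (hY₁ hq)
    · exact hlt p hp.1 q hq.1
    · exact hY₁lt p hp q (by simpa using hq)
  · intro j₁ j₂ j₃ h1 h2 p hp q hq r hr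
    fin_cases j₁ <;> fin_cases j₂ <;> fin_cases j₃ <;> simp at h1 h2 hp hq hr
    · exact hcup p q r (hX₁ hp) (hY₁ hr) (Or.inl hq.1) (hX₁lt p hp q (by simpa using hq))
        (hlt q hq.1 r (hY₁ hr))
    · exact hcup p q r (hX₁ hp) hr.1 (Or.inl hq.1) (hX₁lt p hp q (by simpa using hq))
        (hlt q hq.1 r hr.1)
    · exact hcup p q r (hX₁ hp) hr.1 (Or.inr (hY₁ hq)) (hlt p (hX₁ hp) q (hY₁ hq))
        (hY₁lt q hq r (by simpa using hr))
    · exact hcup p q r hp.1 hr.1 (Or.inr (hY₁ hq)) (hlt p hp.1 q (hY₁ hq))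
        (hY₁lt q hq r (by simpa using hr))

/-- Any `18 m` points in general position have a crossing family of `m` convex quadrilaterals. -/
lemma hasCrossingFamily_four {S : Finset Plane} (hS : OrientNonzero S)
    (hx : ∀ p ∈ S, ∀ q ∈ S, p 0 = q 0 → p = q) {m : ℕ} (hm : 0 < m) (hcard : 18 * m ≤ S.card) :
    HasCrossingFamily S 4 m := by
  classical
  -- The split is 8 + 2 + 8: halving leaves `4 * m` points on each flank and `m` in the middle.
  obtain ⟨A, hAS, hAc, hA⟩ := exists_leftmost hx (by omega : 8 * m ≤ S.card)
  have hRc := Finset.card_sdiff_of_subset hAS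
  have hRS : S \ A ⊆ S := Finset.sdiff_subset
  obtain ⟨C, hCR, hCc, hC⟩ := exists_leftmost (fun p hp q hq ↦ hx p (hRS hp) q (hRS hq))
    (by omega : 2 * m ≤ (S \ A).card)
  have hBc := Finset.card_sdiff_of_subset hCR
  have hBR : (S \ A) \ C ⊆ S \ A := Finset.sdiff_subset
  obtain ⟨s, t, X, hX, Y, hY, Z, hZ, hXc, hYc, hZc, h⟩ := exists_line_separating_middle hS hAS
    (hBR.trans hRS) (hCR.trans hRS) (fun a ha c hc ↦ hA a ha c (hCR hc)) hC
    (fun a ha b hb ↦ hA a ha b (hBR hb)) (p := 4 * m) (q := m) (by omega) (by omega) (by omega)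
    (by omega)
  have hXS := hX.trans hAS
  have hYS := hY.trans (hBR.trans hRS)
  have hZS := hZ.trans (hCR.trans hRS)
  have hXZ : ∀ x ∈ X, ∀ z ∈ Z, x 0 < z 0 := fun x h z h' ↦ hA x (hX h) z (hCR (hZ h'))
  have hZY : ∀ z ∈ Z, ∀ y ∈ Y, z 0 < y 0 := fun z h y h' ↦ hC z (hZ h) y (hY h')
  have hXY : ∀ x ∈ X, ∀ y ∈ Y, x 0 < y 0 := fun x h y h' ↦ hA x (hX h) y (hBR (hY h'))
  rcases h with ⟨h1, h2, h3⟩ | ⟨h1, h2, h3⟩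
  · exact hasCrossingFamily_four_of_below hS hx hXS hYS hZS hXZ hZY hXY h1 h2 h3 hXc hYc hZc
  · refine HasCrossingFamily.of_image (by norm_num) reflect ?_
    refine hasCrossingFamily_four_of_below hS.image_reflect ?_ (Finset.image_subset_image hXS)
      (Finset.image_subset_image hYS) (Finset.image_subset_image hZS) (s := -s) (t := -t)
      ?_ ?_ ?_ ?_ ?_ ?_ ?_ ?_ ?_
    any_goals
      simp only [Finset.forall_mem_image, reflect_zero, reflect_one, reflect.injective.eq_iff]
    any_goals rw [Finset.card_image_of_injective _ reflect.injective]
    any_goals assumption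
    · intro x hx; linarith [h1 x hx]
    · intro x hx; linarith [h2 x hx]
    · intro x hx; linarith [h3 x hx]


/-! ### Polygons with many vertices -/

/-- A set with distinct abscissas can be cut into blocks, ordered from left to right. -/
lemma exists_blocks {S : Finset Plane} (hx : ∀ p ∈ S, ∀ q ∈ S, p 0 = q 0 → p = q) {K s : ℕ}
    (hcard : K * s ≤ S.card) :
    ∃ V : Fin K → Finset Plane, (∀ j, V j ⊆ S) ∧ (∀ j, (V j).card = s) ∧
      ∀ j j', j < j' → ∀ p ∈ V j, ∀ q ∈ V j', p 0 < q 0 := by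
  classical
  induction K generalizing S with
  | zero => exact ⟨fun _ ↦ ∅, fun j ↦ j.elim0, fun j ↦ j.elim0, fun j ↦ j.elim0⟩
  | succ K ih =>
    rw [Nat.succ_mul] at hcard
    obtain ⟨T, hTS, hTc, hT⟩ := exists_leftmost hx (by omega : s ≤ S.card)
    have hRc := Finset.card_sdiff_of_subset hTS
    obtain ⟨V, hV, hVc, hVlt⟩ := ih (S := S \ T)
      (fun p hp q hq ↦ hx p (Finset.sdiff_subset hp) q (Finset.sdiff_subset hq)) (by omega)
    refine ⟨Fin.cons T V, fun j ↦ ?_, fun j ↦ ?_, fun j j' hjj ↦ ?_⟩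
    · cases j using Fin.cases with
      | zero => exact hTS
      | succ j => exact (hV j).trans Finset.sdiff_subset
    · cases j using Fin.cases with
      | zero => exact hTc
      | succ j => exact hVc j
    · cases j' using Fin.cases with
      | zero => exact absurd hjj (Fin.not_lt_zero _)
      | succ j' =>
        cases j using Fin.cases with
        | zero => exact fun p hp q hq ↦ hT p hp q (hV j' hq)
        | succ j => exact hVlt j j' (Fin.succ_lt_succ_iff.1 hjj)

lemma orient_neg_of_above_line {x y z : Plane} {s t : ℝ} (hxz : x 0 < z 0) (hzy : z 0 < y 0)
    (hx : x 1 - s * x 0 ≤ t) (hy : y 1 - s * y 0 ≤ t) (hz : t < z 1 - s * z 0) :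
    orient x z y < 0 := by
  have := orient_pos_of_below_line (x := reflect x) (y := reflect y) (z := reflect z) (s := -s)
    (t := -t) (by simpa using hxz) (by simpa using hzy) (by simp; linarith) (by simp; linarith)
    (by simp; linarith)
  rw [orient_reflect] at this
  linarith

/-- All transversals of three clusters have the same orientation. -/
def SameOrientation {K : ℕ} (V : Fin K → Finset Plane) (i j l : Fin K) : Prop :=
  (∀ p ∈ V i, ∀ q ∈ V j, ∀ r ∈ V l, 0 < orient p q r) ∨
    ∀ p ∈ V i, ∀ q ∈ V j, ∀ r ∈ V l, orient p q r < 0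

lemma SameOrientation.mono {K : ℕ} {V V' : Fin K → Finset Plane} {i j l : Fin K}
    (h : SameOrientation V i j l) (hV : ∀ j, V' j ⊆ V j) : SameOrientation V' i j l :=
  h.imp (fun h p hp q hq r hr ↦ h p (hV _ hp) q (hV _ hq) r (hV _ hr))
    fun h p hp q hq r hr ↦ h p (hV _ hp) q (hV _ hq) r (hV _ hr)

/-- The same type lemma: clusters ordered from left to right contain large subclusters whose
transversals all have the same order type. -/
lemma exists_sameOrientation {S : Finset Plane} (hS : OrientNonzero S) {K : ℕ}
    (T : Finset (Fin K × Fin K × Fin K)) {s : ℕ} (hs : 0 < s) (V : Fin K → Finset Plane)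
    (hVS : ∀ j, V j ⊆ S) (hV : ∀ j j', j < j' → ∀ p ∈ V j, ∀ q ∈ V j', p 0 < q 0)
    (hcard : ∀ j, 2 ^ T.card * s ≤ (V j).card) :
    ∃ V' : Fin K → Finset Plane, (∀ j, V' j ⊆ V j) ∧ (∀ j, s ≤ (V' j).card) ∧
      ∀ τ ∈ T, τ.1 < τ.2.1 → τ.2.1 < τ.2.2 → SameOrientation V' τ.1 τ.2.1 τ.2.2 := by
  classical
  induction T using Finset.induction_on generalizing s with
  | empty => exact ⟨V, fun _ ↦ subset_rfl, by simpa using hcard, by simp⟩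
  | insert τ T hτ ih =>
    -- Each triple of clusters costs one halving, and shrinking clusters preserves orientations
    -- already fixed.
    obtain ⟨V₁, h1, h2, h3⟩ := ih (s := 2 * s) (by omega) fun j ↦ by
      have := hcard j
      rw [Finset.card_insert_of_notMem hτ, pow_succ, mul_assoc] at this
      exact this
    by_cases hord : τ.1 < τ.2.1 ∧ τ.2.1 < τ.2.2
    swap
    · refine ⟨V₁, h1, fun j ↦ by linarith [h2 j], fun σ hσ h h' ↦ ?_⟩
      rcases Finset.mem_insert.1 hσ with rfl | hσ
      · exact absurd ⟨h, h'⟩ hord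
      · exact h3 σ hσ h h'
    obtain ⟨i, j, l⟩ := τ
    obtain ⟨hij, hjl⟩ := hord
    simp only at hij hjl
    have hlt : ∀ a b, a < b → ∀ p ∈ V₁ a, ∀ q ∈ V₁ b, p 0 < q 0 := fun a b hab p hp q hq ↦
      hV a b hab p (h1 a hp) q (h1 b hq)
    obtain ⟨m, t, A, hA, B, hB, C, hC, hAc, hBc, hCc, h⟩ := exists_line_separating_middle hS
      ((h1 i).trans (hVS i)) ((h1 l).trans (hVS l)) ((h1 j).trans (hVS j)) (hlt i j hij)
      (hlt j l hjl) (hlt i l (hij.trans hjl)) (p := s) (q := s) hs (h2 i) (h2 l) (h2 j)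
    set V₂ : Fin K → Finset Plane :=
      fun a ↦ if a = i then A else if a = j then C else if a = l then B else V₁ a with hV₂
    have e1 : V₂ i = A := by simp [hV₂]
    have e2 : V₂ j = C := by simp [hV₂, hij.ne']
    have e3 : V₂ l = B := by simp [hV₂, hjl.ne', (hij.trans hjl).ne']
    have hsub : ∀ a, V₂ a ⊆ V₁ a := by
      intro a
      simp only [hV₂]
      split_ifs with g1 g2 g3
      · rw [g1]; exact hA
      · rw [g2]; exact hC
      · rw [g3]; exact hB
      · exact subset_rfl
    refine ⟨V₂, fun a ↦ (hsub a).trans (h1 a), fun a ↦ ?_, fun σ hσ h5 h6 ↦ ?_⟩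
    · simp only [hV₂]
      split_ifs
      · exact hAc
      · exact hCc
      · exact hBc
      · linarith [h2 a]
    · rcases Finset.mem_insert.1 hσ with rfl | hσ
      · simp only [SameOrientation, e1, e2, e3]
        refine h.imp ?_ ?_
        · rintro ⟨k1, k2, k3⟩ p hp q hq r hr
          exact orient_pos_of_below_line (hlt i j hij p (hA hp) q (hC hq))
            (hlt j l hjl q (hC hq) r (hB hr)) (k1 p hp) (k2 r hr) (k3 q hq)
        · rintro ⟨k1, k2, k3⟩ p hp q hq r hr
          exact orient_neg_of_above_line (hlt i j hij p (hA hp) q (hC hq))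
            (hlt j l hjl q (hC hq) r (hB hr)) (k1 p hp) (k2 r hr) (k3 q hq)
      · exact (h3 σ hσ h5 h6).mono hsub

/-! ### The Erdős–Szekeres theorem for transitive relations on triples -/

/-- There is a sequence of `n + 2` indices ending in `i, j` all of whose consecutive triples are in
the relation. -/
def ChainTo (R : ℕ → ℕ → ℕ → Prop) : ℕ → ℕ → ℕ → Prop
  | 0, i, j => i < j
  | n + 1, j, l => j < l ∧ ∃ i, ChainTo R n i j ∧ R i j l

lemma ChainTo.lt {R : ℕ → ℕ → ℕ → Prop} {n i j : ℕ} (h : ChainTo R n i j) : i < j := by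
  cases n with
  | zero => exact h
  | succ n => exact h.1

/-- `R` is transitive on the increasing triples of indices below `N`. -/
def TripleTrans (R : ℕ → ℕ → ℕ → Prop) (N : ℕ) : Prop :=
  ∀ a b c d, a < b → b < c → c < d → d < N → R a b c → R b c d → R a b d ∧ R a c d

/-- Transitivity upgrades consecutive triples to all triples: a new last index is related first to
pairs containing the old last index, then to all earlier pairs. -/
lemma ChainTo.exists_seq {R : ℕ → ℕ → ℕ → Prop} {N : ℕ} (hR : TripleTrans R N) {n i j : ℕ}
    (h : ChainTo R n i j) (hj : j < N) :
    ∃ v : ℕ → ℕ, (∀ a b, a < b → b ≤ n + 1 → v a < v b) ∧ v n = i ∧ v (n + 1) = j ∧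
      ∀ a b c, a < b → b < c → c ≤ n + 1 → R (v a) (v b) (v c) := by
  induction n generalizing i j with
  | zero =>
    refine ⟨fun a ↦ if a = 0 then i else j, fun a b hab hb ↦ ?_, by simp, by simp,
      fun a b c hab hbc hc ↦ by omega⟩
    obtain rfl : b = 1 := by omega
    obtain rfl : a = 0 := by omega
    simpa using h.lt
  | succ n ih =>
    obtain ⟨hlt, p, hp, hRp⟩ := h
    obtain ⟨v, hmono, hvn, hvn', hv⟩ := ih hp (hlt.trans hj)
    have e : ∀ a, a ≤ n + 1 → Function.update v (n + 2) j a = v a := fun a ha ↦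
      Function.update_of_ne (by omega) _ _
    have hvi : ∀ a, a ≤ n → v a < i := fun a ha ↦ hvn' ▸ hmono a (n + 1) (by omega) le_rfl
    have r1 : ∀ a, a < n → R (v a) p j ∧ R (v a) i j := fun a ha ↦
      hR _ _ _ _ (hvn ▸ hmono a n ha (by omega)) hp.lt hlt hj
        (by have := hv a n (n + 1) ha (by omega) le_rfl; rwa [hvn, hvn'] at this) hRp
    have r2 : ∀ a, a ≤ n → R (v a) i j := fun a ha ↦ by
      rcases ha.eq_or_lt with rfl | ha
      · rwa [hvn]
      · exact (r1 a ha).2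
    have r3 : ∀ a b, a < b → b ≤ n → R (v a) (v b) j := fun a b hab hb ↦
      (hR _ _ _ _ (hmono a b hab (by omega)) (hvi b hb) hlt hj
        (by have := hv a b (n + 1) hab (by omega) le_rfl; rwa [hvn'] at this) (r2 b hb)).1
    refine ⟨Function.update v (n + 2) j, fun a b hab hb ↦ ?_, ?_, Function.update_self ..,
      fun a b c hab hbc hc ↦ ?_⟩
    · rw [e a (by omega)]
      rcases hb.eq_or_lt with rfl | hb
      · rw [show n + 1 + 1 = n + 2 from rfl, Function.update_self]
        rcases (Nat.lt_succ_iff.1 hab).eq_or_lt with rfl | hab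
        · rwa [hvn']
        · exact (hvi a (by omega)).trans hlt
      · rw [e b (by omega)]
        exact hmono a b hab (by omega)
    · rw [e _ le_rfl, hvn']
    · rw [e a (by omega), e b (by omega)]
      rcases hc.eq_or_lt with rfl | hc
      · rw [show n + 1 + 1 = n + 2 from rfl, Function.update_self]
        rcases (Nat.lt_succ_iff.1 hbc).eq_or_lt with rfl | hbc
        · rw [hvn']; exact r2 a (by omega)
        · exact r3 a b hab (by omega)
      · rw [e c (by omega)]
        exact hv a b c hab hbc (by omega)

/-- No transitivity is needed. Label a pair by the lengths of the longest chains of both kinds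
ending in it. The labels of `(i, j)` and `(j, l)` differ, as one length grows. Hence the sets of
labels of pairs ending at `j` differ for different `j`; but without a chain of length `k` only `2 ^
(k * k)` such sets exist. -/
lemma exists_chainTo (R : ℕ → ℕ → ℕ → Prop) (k : ℕ) :
    ∃ i j, i < j ∧ j < 2 ^ (k * k) + 1 ∧
      (ChainTo R k i j ∨ ChainTo (fun a b c ↦ ¬ R a b c) k i j) := by
  classical
  by_contra! hno
  set N := 2 ^ (k * k) + 1
  have hk : 0 < k := by
    rcases Nat.eq_zero_or_pos k with rfl | hk
    · exact absurd (show (0 : ℕ) < 1 by norm_num) (hno 0 1 one_pos (by simp [N])).1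
    · exact hk
  let f (Q : ℕ → ℕ → ℕ → Prop) (i j : ℕ) : ℕ := Nat.findGreatest (fun n ↦ ChainTo Q n i j) (k - 1)
  have step : ∀ Q : ℕ → ℕ → ℕ → Prop, (∀ i j, i < j → j < N → ¬ ChainTo Q k i j) →
      ∀ i j l, i < j → j < l → l < N → Q i j l → f Q i j < f Q j l := by
    intro Q hQ i j l hij hjl hl hq
    have h1 : ChainTo Q (f Q i j) i j :=
      Nat.findGreatest_spec (P := fun n ↦ ChainTo Q n i j) (Nat.zero_le _) hij
    have h2 : ChainTo Q (f Q i j + 1) j l := ⟨hjl, i, h1, hq⟩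
    have h3 : f Q i j ≤ k - 1 := Nat.findGreatest_le _
    have h4 : f Q i j + 1 ≠ k := fun h ↦ hQ j l hjl hl (h ▸ h2)
    exact Nat.le_findGreatest (by omega) h2
  let lab (i j : ℕ) : ℕ × ℕ := (f R i j, f (fun a b c ↦ ¬ R a b c) i j)
  have hlab : ∀ i j l, i < j → j < l → l < N → lab i j ≠ lab j l := by
    intro i j l hij hjl hl h
    by_cases hq : R i j l
    · exact (step R (fun i j hij hj ↦ (hno i j hij hj).1) i j l hij hjl hl hq).ne
        (congrArg Prod.fst h)
    · exact (step _ (fun i j hij hj ↦ (hno i j hij hj).2) i j l hij hjl hl hq).ne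
        (congrArg Prod.snd h)
  let L (j : ℕ) : Finset (ℕ × ℕ) := (Finset.range j).image fun i ↦ lab i j
  have hL : ∀ j l, j < l → l < N → L j ≠ L l := by
    intro j l hjl hl h
    have : lab j l ∈ L j := h ▸ Finset.mem_image_of_mem _ (Finset.mem_range.2 hjl)
    obtain ⟨i, hi, hi'⟩ := Finset.mem_image.1 this
    exact hlab i j l (Finset.mem_range.1 hi) hjl hl hi'
  have hcard : (Finset.range N).card ≤
      ((Finset.range k ×ˢ Finset.range k).powerset).card := by
    refine Finset.card_le_card_of_injOn L ?_ ?_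
    · intro j _
      simp only [Finset.coe_powerset, Set.mem_preimage, Set.mem_powerset_iff, Finset.coe_subset]
      intro x hx
      obtain ⟨i, -, rfl⟩ := Finset.mem_image.1 hx
      have h1 : ∀ Q, f Q i j < k := fun Q ↦
        lt_of_le_of_lt (Nat.findGreatest_le _) (by omega)
      exact Finset.mem_product.2 ⟨Finset.mem_range.2 (h1 _), Finset.mem_range.2 (h1 _)⟩
    · intro j hj l hl h
      rcases lt_trichotomy j l with h' | h' | h'
      · exact absurd h (hL j l h' (by simpa using hl))
      · exact h'
      · exact absurd h.symm (hL l j h' (by simpa using hj))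
  rw [Finset.card_powerset, Finset.card_product, Finset.card_range, Finset.card_range] at hcard
  omega

lemma exists_homogeneous (k : ℕ) (R : ℕ → ℕ → ℕ → Prop)
    (hR : TripleTrans R (2 ^ (k * k) + 1))
    (hR' : TripleTrans (fun a b c ↦ ¬ R a b c) (2 ^ (k * k) + 1)) :
    ∃ v : Fin k → Fin (2 ^ (k * k) + 1), StrictMono v ∧
      ((∀ a b c, a < b → b < c → R (v a) (v b) (v c)) ∨
        ∀ a b c, a < b → b < c → ¬ R (v a) (v b) (v c)) := by
  have main : ∀ Q : ℕ → ℕ → ℕ → Prop, TripleTrans Q (2 ^ (k * k) + 1) →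
      ∀ i j, j < 2 ^ (k * k) + 1 → ChainTo Q k i j →
      ∃ v : Fin k → Fin (2 ^ (k * k) + 1), StrictMono v ∧
        ∀ a b c, a < b → b < c → Q (v a) (v b) (v c) := by
    intro Q hQ i j hj h
    obtain ⟨v, hmono, -, hlast, hv⟩ := h.exists_seq hQ hj
    have hb : ∀ a : Fin k, v a < 2 ^ (k * k) + 1 := fun a ↦
      (hlast ▸ hmono a (k + 1) (by omega) le_rfl : v a < j).trans hj
    -- The chain has `k + 2` indices; the first `k` are kept.
    exact ⟨fun a ↦ ⟨v a, hb a⟩, fun a b hab ↦ Fin.lt_def.2 (hmono a b hab (by omega)),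
      fun a b c hab hbc ↦ hv a b c hab hbc (by omega)⟩
  obtain ⟨i, j, -, hj, h | h⟩ := exists_chainTo R k
  · obtain ⟨v, h1, h2⟩ := main R hR i j hj h
    exact ⟨v, h1, Or.inl h2⟩
  · obtain ⟨v, h1, h2⟩ := main _ hR' i j hj h
    exact ⟨v, h1, Or.inr h2⟩

/-! ### Transitivity of cups and caps, and polygons with k vertices -/

lemma orient_trans {p q r s : Plane} (hpq : p 0 < q 0) (hqr : q 0 < r 0) (hrs : r 0 < s 0)
    (h1 : 0 < orient p q r) (h2 : 0 < orient q r s) :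
    0 < orient p q s ∧ 0 < orient p r s := by
  -- Times the middle gap, both orientations are positive combinations of the given ones.
  have e1 : orient p q s * (r 0 - q 0) =
      orient p q r * (s 0 - q 0) + orient q r s * (q 0 - p 0) := by unfold orient; ring
  have e2 : orient p r s * (r 0 - q 0) =
      orient p q r * (s 0 - r 0) + orient q r s * (r 0 - p 0) := by unfold orient; ring
  have h0 : 0 ≤ r 0 - q 0 := by linarith
  refine ⟨pos_of_mul_pos_left (e1 ▸ ?_) h0, pos_of_mul_pos_left (e2 ▸ ?_) h0⟩ <;>
  exact add_pos (mul_pos h1 (by linarith)) (mul_pos h2 (by linarith))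

lemma orient_trans_neg {p q r s : Plane} (hpq : p 0 < q 0) (hqr : q 0 < r 0) (hrs : r 0 < s 0)
    (h1 : orient p q r < 0) (h2 : orient q r s < 0) : orient p q s < 0 ∧ orient p r s < 0 := by
  have := orient_trans (p := reflect p) (q := reflect q) (r := reflect r) (s := reflect s)
    (by simpa) (by simpa) (by simpa) (by rw [orient_reflect]; linarith)
    (by rw [orient_reflect]; linarith)
  simp only [orient_reflect] at this
  exact ⟨by linarith [this.1], by linarith [this.2]⟩

/-- For every `k ≥ 4` there is `M` such that any `M m` points in general position have a crossing
family of `m` convex `k`-gons. -/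
lemma exists_hasCrossingFamily {k : ℕ} (hk : 4 ≤ k) :
    ∃ M : ℕ, 0 < M ∧ ∀ S : Finset Plane, OrientNonzero S →
      (∀ p ∈ S, ∀ q ∈ S, p 0 = q 0 → p = q) → ∀ m : ℕ, 0 < m → M * m ≤ S.card →
      HasCrossingFamily S k m := by
  classical
  set K := 2 ^ (k * k) + 1 with hK
  set T : Finset (Fin K × Fin K × Fin K) := Finset.univ with hT
  refine ⟨K * 2 ^ T.card, by positivity, fun S hS hx m hm hcard ↦ ?_⟩
  rw [mul_assoc] at hcard
  obtain ⟨V, hVS, hVc, hVlt⟩ := exists_blocks hx hcard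
  obtain ⟨W, hWV, hWc, hW⟩ := exists_sameOrientation hS T hm V hVS hVlt fun j ↦ (hVc j).ge
  have hWS : ∀ j, W j ⊆ S := fun j ↦ (hWV j).trans (hVS j)
  have hWlt : ∀ j j', j < j' → ∀ p ∈ W j, ∀ q ∈ W j', p 0 < q 0 := fun j j' h p hp q hq ↦
    hVlt j j' h p (hWV _ hp) q (hWV _ hq)
  -- One representative per cluster determines the orientation of all transversals.
  choose w hw using fun j ↦ Finset.card_pos.1 (hm.trans_le (hWc j))
  have hwlt : ∀ i j, i < j → w i 0 < w j 0 := fun i j h ↦ hWlt i j h _ (hw i) _ (hw j)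
  -- The value 0 is never used: all indices that occur are below `K`.
  let u : ℕ → Plane := fun a ↦ if h : a < K then w ⟨a, h⟩ else 0
  have hu : ∀ a : Fin K, u a = w a := fun a ↦ by simp [u]
  have hneg : ∀ i j l : Fin K, i < j → j < l → ¬ 0 < orient (w i) (w j) (w l) →
      orient (w i) (w j) (w l) < 0 := by
    intro i j l hij hjl h
    refine lt_of_le_of_ne (not_lt.1 h) (hS _ (hWS _ (hw i)) _ (hWS _ (hw j)) _ (hWS _ (hw l))
      ?_ ?_ ?_)
    · exact fun h ↦ (hwlt i j hij).ne (by rw [h])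
    · exact fun h ↦ (hwlt j l hjl).ne (by rw [h])
    · exact fun h ↦ (hwlt i l (hij.trans hjl)).ne (by rw [h])
  have trans_aux : ∀ a b c d : ℕ, a < b → b < c → c < d → d < K →
      ∃ a' b' c' d' : Fin K, a = a' ∧ b = b' ∧ c = c' ∧ d = d' ∧ a' < b' ∧ b' < c' ∧ c' < d' :=
    fun a b c d h1 h2 h3 h4 ↦ ⟨⟨a, by omega⟩, ⟨b, by omega⟩, ⟨c, by omega⟩, ⟨d, h4⟩, rfl, rfl, rfl,
      rfl, h1, h2, h3⟩
  obtain ⟨v, hv, hhom⟩ := exists_homogeneous k (fun a b c ↦ 0 < orient (u a) (u b) (u c))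
    (by
      intro a b c d h1 h2 h3 h4 r1 r2
      obtain ⟨a, b, c, d, rfl, rfl, rfl, rfl, h1, h2, h3⟩ := trans_aux a b c d h1 h2 h3 h4
      simp only [hu] at r1 r2 ⊢
      exact orient_trans (hwlt _ _ h1) (hwlt _ _ h2) (hwlt _ _ h3) r1 r2)
    (by
      intro a b c d h1 h2 h3 h4 r1 r2
      obtain ⟨a, b, c, d, rfl, rfl, rfl, rfl, h1, h2, h3⟩ := trans_aux a b c d h1 h2 h3 h4
      simp only [hu] at r1 r2 ⊢
      have := orient_trans_neg (hwlt _ _ h1) (hwlt _ _ h2) (hwlt _ _ h3) (hneg _ _ _ h1 h2 r1)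
        (hneg _ _ _ h2 h3 r2)
      exact ⟨this.1.not_gt, this.2.not_gt⟩)
  simp only [hu] at hhom
  rcases hhom with hhom | hhom
  · refine hasCrossingFamily_of_cup_clusters hS hx hk (fun j ↦ W (v j)) (fun j ↦ hWS _)
      (fun j ↦ hWc _) (fun j j' h ↦ hWlt _ _ (hv h)) fun a b c hab hbc ↦ ?_
    rcases hW (v a, v b, v c) (Finset.mem_univ _) (hv hab) (hv hbc) with h | h
    · exact h
    · exact absurd (hhom a b c hab hbc) (h _ (hw _) _ (hw _) _ (hw _)).not_gt
  · refine HasCrossingFamily.of_image (by omega) reflect ?_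
    refine hasCrossingFamily_of_cup_clusters hS.image_reflect ?_ hk
      (fun j ↦ (W (v j)).image reflect) (fun j ↦ Finset.image_subset_image (hWS _)) (fun j ↦ ?_)
      (fun j j' h ↦ ?_) fun a b c hab hbc ↦ ?_
    · simpa only [Finset.forall_mem_image, reflect_zero, reflect.injective.eq_iff] using hx
    · rw [Finset.card_image_of_injective _ reflect.injective]; exact hWc _
    · simpa only [Finset.forall_mem_image, reflect_zero] using hWlt _ _ (hv h)
    · simp only [Finset.forall_mem_image, orient_reflect]
      rcases hW (v a, v b, v c) (Finset.mem_univ _) (hv hab) (hv hbc) with h | h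
      · exact absurd (h _ (hw _) _ (hw _) _ (hw _)) (hhom a b c hab hbc)
      · exact fun p hp q hq r hr ↦ neg_pos.2 (h p hp q hq r hr)

/-- The assumption that the points have distinct abscissas can be achieved by a shear. -/
lemma hasCrossingFamily_of_generic {S : Finset Plane} (hS : InGeneralPosition S) {k m M : ℕ}
    (hk : 4 ≤ k) (hm : 0 < m) (hcard : M * m ≤ S.card)
    (h : ∀ S : Finset Plane, OrientNonzero S → (∀ p ∈ S, ∀ q ∈ S, p 0 = q 0 → p = q) →
      ∀ m : ℕ, 0 < m → M * m ≤ S.card → HasCrossingFamily S k m) : HasCrossingFamily S k m := by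
  classical
  obtain ⟨ε, hε⟩ := exists_shear_injOn S
  refine HasCrossingFamily.of_image (by omega) (shear ε)
    (h _ (hS.orientNonzero.image_shear ε) ?_ m hm ?_)
  · simp only [Finset.forall_mem_image]
    exact fun p hp q hq h ↦ by rw [hε p hp q hq h]
  · rwa [Finset.card_image_of_injective _ (shear ε).injective]

theorem mainTheorem7 :
    ∃ c : ℕ → ℝ, c 4 = 1 / 22 ∧
      ∀ k : ℕ, 4 ≤ k → 0 < c k ∧
        ∃ N : ℕ, ∀ S : Finset Plane, InGeneralPosition S → N ≤ S.card →
          ∃ F : Finset (GeomCycle S k),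
            (∀ C ∈ F, C.IsSimpleConvex) ∧ IsCrossingFamily F ∧
              c k * (S.card : ℝ) ≤ (F.card : ℝ) := by
  classical
  choose! M hM hfam using fun (k : ℕ) (hk : 4 ≤ k) ↦ exists_hasCrossingFamily hk
  -- The factor 2 absorbs the rounding in `S.card / M k`.
  refine ⟨fun k ↦ if k = 4 then 1 / 22 else 1 / (2 * M k), by simp, fun k hk ↦ ?_⟩
  by_cases hk4 : k = 4
  · subst hk4
    refine ⟨by norm_num, 100, fun S hS hN ↦ ?_⟩
    -- Here `m` is n/22 rounded up. Since `m ≤ (n + 21) / 22`, the bound `18 * m ≤ n` follows from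
    -- 378 ≤ 4n, which holds for n ≥ 100.
    obtain ⟨F, hF, hcr, hcard⟩ := hasCrossingFamily_of_generic hS (k := 4) (M := 18)
      (m := (S.card + 21) / 22) le_rfl (by omega) (by omega)
      fun S hS hx m hm ↦ hasCrossingFamily_four hS hx hm
    refine ⟨F, hF, hcr, ?_⟩
    have : S.card ≤ 22 * F.card := by omega
    have : (S.card : ℝ) ≤ 22 * F.card := by exact_mod_cast this
    simp only [if_true]
    linarith
  · have hMk := hM k hk
    have hMk' : (0 : ℝ) < M k := by exact_mod_cast hMk
    simp only [if_neg hk4]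
    refine ⟨by positivity, 2 * M k, fun S hS hN ↦ ?_⟩
    have hdiv := Nat.div_add_mod S.card (M k)
    have hmod := Nat.mod_lt S.card hMk
    have hpos : 0 < S.card / M k := Nat.div_pos (by omega) hMk
    obtain ⟨F, hF, hcr, hcard⟩ := hasCrossingFamily_of_generic hS (M := M k) hk hpos (by omega)
      (hfam k hk)
    refine ⟨F, hF, hcr, ?_⟩
    have h1 : S.card ≤ 2 * M k * F.card := by
      have := Nat.mul_le_mul_left (M k) hcard
      have := Nat.mul_le_mul_left (M k) (Nat.succ_le_of_lt hpos)
      nlinarith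
    have h2 : (S.card : ℝ) ≤ 2 * M k * F.card := by exact_mod_cast h1
    rw [div_mul_eq_mul_div, one_mul, div_le_iff₀ (by positivity)]
    linarith
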